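/- Conventions. Let $D\subset\mathbb{R}^2$ be the closed unit disk and $B\subset\partial D$ a finite set. A \emph{smoothing with boundary $B$} is a compact one-dimensional submanifold of $D$ (a finite disjoint union of simple arcs and simple closed curves) that meets $\partial D$ exactly in its set of endpoints $B$. The category $\mathrm{Cob}(B)$ has these smoothings as objects; a morphism $O\to O'$ is a compact surface (necessarily orientable) properly and locally flatly embedded in $D\times[0,1]$ with boundary $(O\times\{0\})\cup(B\times[0,1])\cup(O'\times\{1\})$, which is a product near the bottom and the top, taken up to boundary-preserving ambient isotopy; composition is stacking followed by vertical renormalization. We regard $\mathrm{Cob}(B)$ as a preadditive category by replacing its Hom-sets by the free abelian groups on them. For a preadditive category $\mathcal{C}$, $\mathrm{Mat}(\mathcal{C})$ is the category of finite formal direct sums of objects of $\mathcal{C}$ and matrices of morphisms, and $\mathrm{Kom}(\mathcal{C})$ is the category of cochain complexes $\cdots\to C_i\xrightarrow{\partial_i}C_{i+1}\to\cdots$ over $\mathcal{C}$, with $\partial_{i+1}\circ\partial_i=0$ for all $i\in\mathbb{Z}$ and only finitely many nonzero terms, and chain maps. Let $T$ be an oriented tangle diagram in $D$ with endpoints $\partial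 T\subset\partial D$ and with crossings numbered $1,\dots,n$, of which $n_-$ are negative. For a word $w\in\{0,1\}^n$ let $T_w\in\mathrm{Cob}(\partial T)$ be the smoothing obtained by replacing, inside a small disk around it, the $k$-th crossing by its $w_k$-smoothing for each $k$; here the $0$-smoothing of a crossing joins the two regions swept out when the upper strand is rotated counterclockwise towards the lower strand, and the $1$-smoothing joins the other two regions. If $w_j=0$ and $w'$ is obtained from $w$ by changing the $j$-th letter to $1$, let $M_{w,j}\colon T_w\to T_{w'}$ be the cobordism that is a saddle over the small disk around the $j$-th crossing and a product with $[0,1]$ elsewhere. Define, for $i\in\mathbb{Z}$, $$\llbracket T\rrbracket^i=\bigoplus_{w\in\{0,1\}^n,\ \sum_k w_k=i+n_-}T_w\ \in\ \mathrm{Mat}(\mathrm{Cob}(\partial T)),$$ and let $\partial_i\colon\llbracket T\rrbracket^i\to\llbracket T\rrbracket^{i+1}$ be the matrix whose entry from $T_w$ to $T_{w'}$ is $(-1)^{\sum_{k<j}w_k}M_{w,j}$ if $w'$ is obtained from $w$ by changing the $j$-th letter from $0$ to $1$, and $0$ if there is no such $j$. Proposition. For every oriented tangle diagram $T$, the Khovanov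 bracket $\llbracket T\rrbracket=(\llbracket T\rrbracket^i,\partial_i)_{i\in\mathbb{Z}}$ is an object of $\mathrm{Kom}(\mathrm{Mat}(\mathrm{Cob}(\partial T)))$: one has $\partial_{i+1}\circ\partial_i=0$ for all $i\in\mathbb{Z}$, and only finitely many of the $\llbracket T\rrbracket^i$ are nonzero. -/

import Mathlib

open CategoryTheory Set

noncomputable section

namespace Khovanov

/-! ### Locally flat subsets of the disk and of the cylinder -/

/-- The closed unit disk. -/
abbrev Disk : Type := Metric.closedBall (0 : ℂ) 1

/-- The cylinder over the disk; the second coordinate is the height. -/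
abbrev Cylinder : Type := Disk × unitInterval

instance : CompactSpace Disk := isCompact_iff_compactSpace.mp (isCompact_closedBall 0 1)

/-- A point of the boundary circle, as a point of the disk. -/
def toDisk (z : Circle) : Disk := ⟨z, by simp [Circle.norm_coe]⟩

/-- The horizontal diameter of the disk. -/
def diameter : Set Disk := {z | (z : ℂ).im = 0}

/-- Near `p` the pair `(X, S)` is homeomorphic to the pair `(X, F)` near some point. -/
def LocallyModelledAt {X : Type} [TopologicalSpace X] (F S : Set X) (p : X) : Prop :=
  ∃ e : OpenPartialHomeomorph X X, p ∈ e.source ∧ ∀ x ∈ e.source, x ∈ S ↔ e x ∈ F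

/-- Every point of `S` has a neighbourhood in which the pair `(X, S)` looks like `(X, F)`. -/
def LocallyModelled {X : Type} [TopologicalSpace X] (F S : Set X) : Prop :=
  ∀ p ∈ S, LocallyModelledAt F S p

lemma LocallyModelledAt.pullback {X : Type} [TopologicalSpace X] {F S S' : Set X} {p : X}
    (g : OpenPartialHomeomorph X X) (hp : p ∈ g.source)
    (hg : ∀ x ∈ g.source, x ∈ S ↔ g x ∈ S') (h : LocallyModelledAt F S' (g p)) :
    LocallyModelledAt F S p := by
  obtain ⟨e, he, hs⟩ := h
  refine ⟨g.trans e, by simp [hp, he], fun x hx => ?_⟩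
  simp only [OpenPartialHomeomorph.trans_source, mem_inter_iff, mem_preimage] at hx
  rw [hg x hx.1, hs _ hx.2]; rfl

lemma LocallyModelledAt.congr {X : Type} [TopologicalSpace X] {F S S' : Set X} {p : X}
    (U : Set X) (hU : IsOpen U) (hp : p ∈ U) (h : ∀ x ∈ U, x ∈ S ↔ x ∈ S')
    (hS : LocallyModelledAt F S' p) : LocallyModelledAt F S p :=
  LocallyModelledAt.pullback (OpenPartialHomeomorph.ofSet U hU) hp h hS

lemma LocallyModelledAt.prod_univ {F S : Set Disk} {p : Cylinder}
    (h : LocallyModelledAt F S p.1) :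
    LocallyModelledAt (F ×ˢ (univ : Set unitInterval)) (S ×ˢ univ) p := by
  obtain ⟨e, he, hs⟩ := h
  refine ⟨e.prod (OpenPartialHomeomorph.refl _), by simp [he], fun x hx => ?_⟩
  have : x.1 ∈ e.source := by simpa using hx
  simpa using hs _ this

/-! ### Smoothings and cobordisms -/

/-- A smoothing with boundary `B`: a compact one-dimensional submanifold of the disk (a finite
disjoint union of simple arcs and simple closed curves), meeting the boundary circle exactly in
its endpoints, which are the points of `B`. -/
structure Smoothing (B : Finset Circle) where
  carrier : Set Disk
  isClosed : IsClosed carrier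
  flat : LocallyModelled diameter carrier
  boundary : ∀ z : Circle, toDisk z ∈ carrier ↔ z ∈ B

/-- A cobordism from `O` to `O'`: a compact surface embedded (properly, and locally flatly) in the
cylinder, whose boundary is `O × {0} ∪ B × [0, 1] ∪ O' × {1}`. As usual it is taken to be a product
near the bottom and near the top, so that cobordisms can be stacked. Every such surface is
orientable; since smoothings carry no orientation, none is chosen. -/
structure Cobordism {B : Finset Circle} (O O' : Smoothing B) where
  carrier : Set Cylinder
  isClosed : IsClosed carrier
  flat : LocallyModelled (diameter ×ˢ (univ : Set unitInterval)) carrier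
  side : ∀ (z : Circle) (t : unitInterval), (toDisk z, t) ∈ carrier ↔ z ∈ B
  collar : ∃ ε : ℝ, 0 < ε ∧
    (∀ (z : Disk) (t : unitInterval), (t : ℝ) ≤ ε → ((z, t) ∈ carrier ↔ z ∈ O.carrier)) ∧
    (∀ (z : Disk) (t : unitInterval), 1 - ε ≤ (t : ℝ) → ((z, t) ∈ carrier ↔ z ∈ O'.carrier))

/-- `S` and `S'` are related by a boundary preserving isotopy: a continuous family `H s` of
self-homeomorphisms of the cylinder, starting at the identity and carrying `S` to `S'`, which fixes
the bottom and the top disk pointwise and preserves each vertical line on the side. -/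
def Isotopic (S S' : Set Cylinder) : Prop :=
  ∃ H : unitInterval → Cylinder → Cylinder,
    Continuous (fun q : unitInterval × Cylinder => H q.1 q.2) ∧
    (∀ s, IsHomeomorph (H s)) ∧
    H 0 = id ∧
    H 1 '' S = S' ∧
    (∀ s z, H s (z, 0) = (z, 0)) ∧
    (∀ s z, H s (z, 1) = (z, 1)) ∧
    (∀ s (z : Circle) p, (H s p).1 = toDisk z ↔ p.1 = toDisk z)

lemma image_eq_iff {X : Type} {f : X → X} (hf : Function.Bijective f) {S S' : Set X} :
    f '' S = S' ↔ ∀ x, f x ∈ S' ↔ x ∈ S := by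
  constructor
  · rintro rfl x
    exact hf.1.mem_set_image
  · intro h
    ext y
    obtain ⟨x, rfl⟩ := hf.2 y
    rw [hf.1.mem_set_image, h]

lemma Isotopic.refl (S : Set Cylinder) : Isotopic S S :=
  ⟨fun _ => id, continuous_snd, fun _ => IsHomeomorph.id, rfl, by simp, by simp, by simp, by simp⟩

lemma Isotopic.symm {S S' : Set Cylinder} (h : Isotopic S S') : Isotopic S' S := by
  obtain ⟨H, hc, hh, h0, h1, hb, ht, hs⟩ := h
  obtain ⟨e, he⟩ : ∃ e : Cylinder ≃ₜ Cylinder, ∀ x, e x = H 1 x :=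
    ⟨(hh 1).homeomorph, fun _ => rfl⟩
  refine ⟨fun s p => H (unitInterval.symm s) (e.symm p), ?_, ?_, ?_, ?_, ?_, ?_, ?_⟩
  · exact hc.comp ((unitInterval.continuous_symm.comp continuous_fst).prodMk
      (e.symm.continuous.comp continuous_snd))
  · exact fun s => (hh _).comp e.symm.isHomeomorph
  · funext p
    simp [← he]
  · refine (image_eq_iff ((hh _).comp e.symm.isHomeomorph).bijective).2 fun x => ?_
    simp only [Function.comp_apply, unitInterval.symm_one, h0, id]
    rw [← (image_eq_iff (hh 1).bijective).1 h1 (e.symm x), ← he, e.apply_symm_apply]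
  · intro s z
    have : e.symm (z, 0) = (z, 0) := by rw [Homeomorph.symm_apply_eq, he, hb]
    simp [this, hb]
  · intro s z
    have : e.symm (z, 1) = (z, 1) := by rw [Homeomorph.symm_apply_eq, he, ht]
    simp [this, ht]
  · intro s z p
    rw [hs, ← hs 1, ← he, e.apply_symm_apply]

lemma Isotopic.trans {S S' S'' : Set Cylinder} (h : Isotopic S S') (h' : Isotopic S' S'') :
    Isotopic S S'' := by
  obtain ⟨H, hc, hh, h0, h1, hb, ht, hs⟩ := h
  obtain ⟨K, kc, kh, k0, k1, kb, kt, ks⟩ := h'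
  refine ⟨fun s p => K s (H s p), ?_, ?_, ?_, ?_, ?_, ?_, ?_⟩
  · exact kc.comp (continuous_fst.prodMk hc)
  · exact fun s => (kh s).comp (hh s)
  · simp [h0, k0]; rfl
  · rw [← k1, ← h1, image_image]
  · simp [hb, kb]
  · simp [ht, kt]
  · simp [hs, ks]

/-- Two sets that differ by an increasing reparametrization of the height are isotopic. -/
lemma Isotopic.of_reparam {S S' : Set Cylinder} (f : unitInterval → unitInterval)
    (hf : Continuous f) (hm : StrictMono f) (h0 : f 0 = 0) (h1 : f 1 = 1)
    (h : ∀ z t, (z, f t) ∈ S' ↔ (z, t) ∈ S) : Isotopic S S' := by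
  have mem : ∀ s t : unitInterval, (1 - (s : ℝ)) * t + s * f t ∈ Icc (0 : ℝ) 1 := by
    intro s t
    have hs := s.2; have ht := t.2; have hft := (f t).2
    simp only [mem_Icc] at hs ht hft ⊢
    constructor
    · have := mul_nonneg (sub_nonneg.2 hs.2) ht.1
      have := mul_nonneg hs.1 hft.1
      linarith
    · have := mul_le_mul_of_nonneg_left ht.2 (sub_nonneg.2 hs.2)
      have := mul_le_mul_of_nonneg_left hft.2 hs.1
      linarith
  let g : unitInterval → unitInterval → unitInterval := fun s t => ⟨_, mem s t⟩
  have gc : Continuous (fun q : unitInterval × unitInterval => g q.1 q.2) := by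
    apply Continuous.subtype_mk
    fun_prop
  have gm : ∀ s, StrictMono (g s) := by
    intro s a b hab
    have hs := s.2
    have h1 : (a : ℝ) < b := hab
    have h2 : (f a : ℝ) < f b := hm hab
    change (1 - (s : ℝ)) * a + s * f a < (1 - (s : ℝ)) * b + s * f b
    rcases eq_or_lt_of_le hs.1 with h | h
    · rw [← h]; linarith
    · have := mul_lt_mul_of_pos_left h2 h
      have := mul_le_mul_of_nonneg_left h1.le (sub_nonneg.2 hs.2)
      linarith
  have g0 : ∀ s, g s 0 = 0 := fun s => by ext; simp [g, h0]
  have g1 : ∀ s, g s 1 = 1 := fun s => by ext; simp [g, h1]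
  have gs : ∀ s, Function.Surjective (g s) := by
    intro s y
    have hcs : Continuous (g s) := gc.comp (continuous_const.prodMk continuous_id)
    have := intermediate_value_univ (0 : unitInterval) 1 hcs
    rw [g0, g1] at this
    exact this ⟨unitInterval.nonneg', unitInterval.le_one'⟩
  have bij : ∀ s, Function.Bijective (fun p : Cylinder => ((p.1, g s p.2) : Cylinder)) := fun s =>
    Function.Bijective.prodMap Function.bijective_id ⟨(gm s).injective, gs s⟩
  refine ⟨fun s p => (p.1, g s p.2), ?_, ?_, ?_, ?_, ?_, ?_, ?_⟩
  · exact (continuous_fst.comp continuous_snd).prodMk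
      (gc.comp (continuous_fst.prodMk (continuous_snd.comp continuous_snd)))
  · intro s
    rw [isHomeomorph_iff_continuous_bijective]
    exact ⟨continuous_fst.prodMk (gc.comp (continuous_const.prodMk continuous_snd)), bij s⟩
  · funext p
    refine Prod.ext rfl (Subtype.ext ?_)
    simp [g]
  · rw [image_eq_iff (bij 1)]
    rintro ⟨z, t⟩
    have : g 1 t = f t := by ext; simp [g]
    simp [this, h]
  · simp [g0]
  · simp [g1]
  · simp

/-! ### Stacking -/

/-- The height in the lower half of a stack, rescaled to the unit interval. -/
def lower (t : unitInterval) : unitInterval := projIcc 0 1 zero_le_one (2 * (t : ℝ))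

/-- The height in the upper half of a stack, rescaled to the unit interval. -/
def upper (t : unitInterval) : unitInterval := projIcc 0 1 zero_le_one (2 * (t : ℝ) - 1)

/-- `S₁` in the lower half of the cylinder and `S₂` in the upper half, vertically rescaled. -/
def stack (S₁ S₂ : Set Cylinder) : Set Cylinder :=
  {p | ((p.2 : ℝ) ≤ 1 / 2 ∧ (p.1, lower p.2) ∈ S₁) ∨ (1 / 2 ≤ (p.2 : ℝ) ∧ (p.1, upper p.2) ∈ S₂)}

lemma continuous_lower : Continuous lower := by unfold lower; fun_prop

lemma continuous_upper : Continuous upper := by unfold upper; fun_prop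

lemma coe_lower {t : unitInterval} (h : (t : ℝ) ≤ 1 / 2) : (lower t : ℝ) = 2 * t := by
  have := t.2.1
  rw [lower, projIcc_of_mem _ (by constructor <;> linarith)]

lemma coe_upper {t : unitInterval} (h : 1 / 2 ≤ (t : ℝ)) : (upper t : ℝ) = 2 * t - 1 := by
  have := t.2.2
  rw [upper, projIcc_of_mem _ (by constructor <;> linarith)]

/-- The inclusion of the lower half. -/
def half (t : unitInterval) : unitInterval :=
  ⟨t / 2, by have := t.2.1; have := t.2.2; constructor <;> linarith⟩

/-- The inclusion of the upper half. -/
def halfUp (t : unitInterval) : unitInterval :=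
  ⟨t / 2 + 1 / 2, by have := t.2.1; have := t.2.2; constructor <;> linarith⟩

lemma continuous_half : Continuous half := by unfold half; fun_prop

lemma continuous_halfUp : Continuous halfUp := by unfold halfUp; fun_prop

@[simp] lemma coe_half (t : unitInterval) : (half t : ℝ) = t / 2 := rfl

@[simp] lemma coe_halfUp (t : unitInterval) : (halfUp t : ℝ) = t / 2 + 1 / 2 := rfl

@[simp] lemma lower_half (t : unitInterval) : lower (half t) = t := by
  have := t.2.2
  ext; rw [coe_lower (by simp; linarith)]; simp; ring

@[simp] lemma upper_halfUp (t : unitInterval) : upper (halfUp t) = t := by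
  have := t.2.1
  ext; rw [coe_upper (by simp; linarith)]; simp; ring

lemma half_lower {t : unitInterval} (h : (t : ℝ) ≤ 1 / 2) : half (lower t) = t := by
  ext; simp [coe_lower h]

lemma halfUp_upper {t : unitInterval} (h : 1 / 2 ≤ (t : ℝ)) : halfUp (upper t) = t := by
  ext; rw [coe_halfUp, coe_upper h]; ring

lemma lower_eq_one {t : unitInterval} (h : (t : ℝ) = 1 / 2) : lower t = 1 := by
  ext; simp [coe_lower h.le, h]

lemma upper_eq_zero {t : unitInterval} (h : (t : ℝ) = 1 / 2) : upper t = 0 := by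
  ext; simp [coe_upper h.ge, h]

/-- Stacking of self-maps of the cylinder. -/
def stackMap (f g : Cylinder → Cylinder) (p : Cylinder) : Cylinder :=
  if (p.2 : ℝ) ≤ 1 / 2 then ((f (p.1, lower p.2)).1, half (f (p.1, lower p.2)).2)
  else ((g (p.1, upper p.2)).1, halfUp (g (p.1, upper p.2)).2)

lemma stackMap_lower {f g : Cylinder → Cylinder} {p : Cylinder} (h : (p.2 : ℝ) ≤ 1 / 2) :
    stackMap f g p = ((f (p.1, lower p.2)).1, half (f (p.1, lower p.2)).2) := by
  rw [stackMap, if_pos h]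

lemma stackMap_upper {f g : Cylinder → Cylinder} {p : Cylinder}
    (hf : ∀ z, f (z, 1) = (z, 1)) (hg : ∀ z, g (z, 0) = (z, 0)) (h : 1 / 2 ≤ (p.2 : ℝ)) :
    stackMap f g p = ((g (p.1, upper p.2)).1, halfUp (g (p.1, upper p.2)).2) := by
  rcases h.eq_or_lt with h | h
  · rw [stackMap, if_pos h.ge, lower_eq_one h.symm, upper_eq_zero h.symm, hf, hg]
    refine Prod.ext rfl (Subtype.ext ?_)
    simp
  · rw [stackMap, if_neg (not_le.2 h)]

lemma stackMap_comp {f g f' g' : Cylinder → Cylinder}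
    (hf : ∀ z, f (z, 1) = (z, 1)) (hg : ∀ z, g (z, 0) = (z, 0))
    (hf' : ∀ z, f' (z, 1) = (z, 1)) (hg' : ∀ z, g' (z, 0) = (z, 0)) (p : Cylinder) :
    stackMap f g (stackMap f' g' p) = stackMap (f ∘ f') (g ∘ g') p := by
  rcases le_total (p.2 : ℝ) (1 / 2) with h | h
  · rw [stackMap_lower h, stackMap_lower h, stackMap_lower]
    · simp
    · have := (f' (p.1, lower p.2)).2.2.2
      simp; linarith
  · rw [stackMap_upper hf' hg' h, stackMap_upper (by simp [hf, hf']) (by simp [hg, hg']) h,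
      stackMap_upper hf hg]
    · simp
    · have := (g' (p.1, upper p.2)).2.2.1
      simp; linarith

lemma stackMap_id (p : Cylinder) : stackMap id id p = p := by
  rcases le_total (p.2 : ℝ) (1 / 2) with h | h
  · rw [stackMap_lower h]; simp [half_lower h]
  · rw [stackMap_upper (by simp) (by simp) h]; simp [halfUp_upper h]

lemma stackMap_bijective {f g : Cylinder → Cylinder} (bf : Function.Bijective f)
    (bg : Function.Bijective g)
    (hf : ∀ z, f (z, 1) = (z, 1)) (hg : ∀ z, g (z, 0) = (z, 0)) :
    Function.Bijective (stackMap f g) := by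
  obtain ⟨f', hl, hr⟩ := Function.bijective_iff_has_inverse.1 bf
  obtain ⟨g', kl, kr⟩ := Function.bijective_iff_has_inverse.1 bg
  have hf' : ∀ z, f' (z, 1) = (z, 1) := fun z => by simpa [hf] using hl (z, 1)
  have hg' : ∀ z, g' (z, 0) = (z, 0) := fun z => by simpa [hg] using kl (z, 0)
  refine Function.bijective_iff_has_inverse.2 ⟨stackMap f' g', fun p => ?_, fun p => ?_⟩
  · rw [stackMap_comp hf' hg' hf hg, hl.comp_eq_id, kl.comp_eq_id, stackMap_id]
  · rw [stackMap_comp hf hg hf' hg', hr.comp_eq_id, kr.comp_eq_id, stackMap_id]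

/-- The two halves of a stack match along the middle disk. -/
def Match (S₁ S₂ : Set Cylinder) : Prop := ∀ z, (z, 1) ∈ S₁ ↔ (z, 0) ∈ S₂

lemma mem_stack_lower {S₁ S₂ : Set Cylinder} (hS : Match S₁ S₂) {p : Cylinder}
    (h : (p.2 : ℝ) ≤ 1 / 2) : p ∈ stack S₁ S₂ ↔ (p.1, lower p.2) ∈ S₁ := by
  simp only [stack, mem_ofPred_eq]
  constructor
  · rintro (h' | h')
    · exact h'.2
    · have e := le_antisymm h h'.1
      rw [lower_eq_one e, hS, ← upper_eq_zero e]
      exact h'.2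
  · exact fun h' => Or.inl ⟨h, h'⟩

lemma mem_stack_upper {S₁ S₂ : Set Cylinder} (hS : Match S₁ S₂) {p : Cylinder}
    (h : 1 / 2 ≤ (p.2 : ℝ)) : p ∈ stack S₁ S₂ ↔ (p.1, upper p.2) ∈ S₂ := by
  simp only [stack, mem_ofPred_eq]
  constructor
  · rintro (h' | h')
    · have e := le_antisymm h'.1 h
      rw [upper_eq_zero e, ← hS, ← lower_eq_one e]
      exact h'.2
    · exact h'.2
  · exact fun h' => Or.inr ⟨h, h'⟩

lemma Isotopic.stack {S₁ S₂ S₁' S₂' : Set Cylinder} (hS : Match S₁ S₂) (hS' : Match S₁' S₂')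
    (h₁ : Isotopic S₁ S₁') (h₂ : Isotopic S₂ S₂') :
    Isotopic (stack S₁ S₂) (stack S₁' S₂') := by
  obtain ⟨H, hc, hh, h0, h1, hb, ht, hs⟩ := h₁
  obtain ⟨K, kc, kh, k0, k1, kb, kt, ks⟩ := h₂
  have bij : ∀ s, Function.Bijective (stackMap (H s) (K s)) := fun s =>
    stackMap_bijective (hh s).bijective (kh s).bijective (ht s) (kb s)
  have cont : Continuous (fun q : unitInterval × Cylinder => stackMap (H q.1) (K q.1) q.2) := by
    have c1 : Continuous (fun q : unitInterval × Cylinder => H q.1 (q.2.1, lower q.2.2)) :=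
      hc.comp (continuous_fst.prodMk ((continuous_fst.comp continuous_snd).prodMk
        (continuous_lower.comp (continuous_snd.comp continuous_snd))))
    have c2 : Continuous (fun q : unitInterval × Cylinder => K q.1 (q.2.1, upper q.2.2)) :=
      kc.comp (continuous_fst.prodMk ((continuous_fst.comp continuous_snd).prodMk
        (continuous_upper.comp (continuous_snd.comp continuous_snd))))
    unfold stackMap
    refine Continuous.if_le ?_ ?_ (by fun_prop) continuous_const ?_
    · exact (continuous_fst.comp c1).prodMk (continuous_half.comp (continuous_snd.comp c1))
    · exact (continuous_fst.comp c2).prodMk (continuous_halfUp.comp (continuous_snd.comp c2))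
    · intro q hq
      rw [lower_eq_one hq, upper_eq_zero hq, ht, kb]
      refine Prod.ext rfl (Subtype.ext ?_)
      simp
  refine ⟨fun s => stackMap (H s) (K s), cont, ?_, ?_, ?_, ?_, ?_, ?_⟩
  · intro s
    rw [isHomeomorph_iff_continuous_bijective]
    exact ⟨cont.comp (continuous_const.prodMk continuous_id), bij s⟩
  · funext p
    simp only [h0, k0, stackMap_id, id]
  · rw [image_eq_iff (bij 1)]
    intro p
    rw [image_eq_iff (hh 1).bijective] at h1
    rw [image_eq_iff (kh 1).bijective] at k1
    rcases le_total (p.2 : ℝ) (1 / 2) with h | h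
    · rw [stackMap_lower h, mem_stack_lower hS h, mem_stack_lower hS']
      · simp [h1]
      · have := (H 1 (p.1, lower p.2)).2.2.2
        simp; linarith
    · rw [stackMap_upper (ht 1) (kb 1) h, mem_stack_upper hS h, mem_stack_upper hS']
      · simp [k1]
      · have := (K 1 (p.1, upper p.2)).2.2.1
        simp; linarith
  · intro s z
    show stackMap (H s) (K s) (z, 0) = (z, 0)
    rw [stackMap_lower (by simp)]
    have : lower 0 = 0 := by ext; rw [coe_lower] <;> simp
    simp only [this, hb]
    refine Prod.ext rfl (Subtype.ext ?_)
    simp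
  · intro s z
    show stackMap (H s) (K s) (z, 1) = (z, 1)
    rw [stackMap_upper (ht s) (kb s) (by norm_num)]
    have : upper 1 = 1 := by ext; rw [coe_upper] <;> norm_num
    simp only [this, kt]
    refine Prod.ext rfl (Subtype.ext ?_)
    simp; norm_num
  · intro s z p
    show (stackMap (H s) (K s) p).1 = toDisk z ↔ p.1 = toDisk z
    rcases le_total (p.2 : ℝ) (1 / 2) with h | h
    · rw [stackMap_lower h]; simp [hs]
    · rw [stackMap_upper (ht s) (kb s) h]; simp [ks]

lemma LocallyModelledAt.reparam {F : Set Disk} {S S' : Set Cylinder}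
    (f : unitInterval → unitInterval) (hf : Continuous f)
    (g : unitInterval → unitInterval) (hg : Continuous g)
    (U V : Set unitInterval) (hU : IsOpen U) (hV : IsOpen V)
    (hUV : ∀ t ∈ U, f t ∈ V) (hVU : ∀ t ∈ V, g t ∈ U)
    (hfg : ∀ t ∈ U, g (f t) = t) (hgf : ∀ t ∈ V, f (g t) = t)
    (hS : ∀ z, ∀ t ∈ U, (z, t) ∈ S ↔ (z, f t) ∈ S') {p : Cylinder} (hp : p.2 ∈ U)
    (h : LocallyModelledAt (F ×ˢ (univ : Set unitInterval)) S' (p.1, f p.2)) :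
    LocallyModelledAt (F ×ˢ (univ : Set unitInterval)) S p := by
  let e : OpenPartialHomeomorph unitInterval unitInterval :=
    { toFun := f, invFun := g, source := U, target := V, map_source' := hUV, map_target' := hVU
      left_inv' := hfg, right_inv' := hgf, open_source := hU, open_target := hV
      continuousOn_toFun := hf.continuousOn, continuousOn_invFun := hg.continuousOn }
  refine LocallyModelledAt.pullback ((OpenPartialHomeomorph.refl Disk).prod e) (S' := S') ?_ ?_ ?_
  · simpa [e] using hp
  · intro x hx
    have : x.2 ∈ U := by simpa [e] using hx
    exact hS x.1 x.2 this
  · exact h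

namespace Cobordism

variable {B : Finset Circle} {O O' O'' Q : Smoothing B}

lemma mem_zero (S : Cobordism O O') (z : Disk) : (z, 0) ∈ S.carrier ↔ z ∈ O.carrier := by
  obtain ⟨ε, h, h0, -⟩ := S.collar
  exact h0 z 0 (by simpa using h.le)

lemma mem_one (S : Cobordism O O') (z : Disk) : (z, 1) ∈ S.carrier ↔ z ∈ O'.carrier := by
  obtain ⟨ε, h, -, h1⟩ := S.collar
  exact h1 z 1 (by simpa using h.le)

lemma fits (S : Cobordism O O') (S' : Cobordism O' O'') : Match S.carrier S'.carrier :=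
  fun z => by rw [mem_one, mem_zero]

/-- The identity cobordism `O × [0, 1]`. -/
def refl (O : Smoothing B) : Cobordism O O where
  carrier := O.carrier ×ˢ univ
  isClosed := O.isClosed.prod isClosed_univ
  flat p hp := (O.flat p.1 hp.1).prod_univ
  side z t := by simpa using O.boundary z
  collar := ⟨1, one_pos, by simp, by simp⟩

/-- Composition of cobordisms: the second on top of the first, vertically renormalized. -/
def comp (S : Cobordism O O') (S' : Cobordism O' O'') : Cobordism O O'' where
  carrier := stack S.carrier S'.carrier
  isClosed := by
    have c : Continuous fun p : Cylinder => (p.2 : ℝ) := by fun_prop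
    have c1 : Continuous fun p : Cylinder => ((p.1, lower p.2) : Cylinder) :=
      continuous_fst.prodMk (continuous_lower.comp continuous_snd)
    have c2 : Continuous fun p : Cylinder => ((p.1, upper p.2) : Cylinder) :=
      continuous_fst.prodMk (continuous_upper.comp continuous_snd)
    exact ((isClosed_le c continuous_const).inter (S.isClosed.preimage c1)).union
      ((isClosed_le continuous_const c).inter (S'.isClosed.preimage c2))
  flat := by
    intro p hp
    have hm := S.fits S'
    rcases lt_trichotomy (p.2 : ℝ) (1 / 2) with h | h | h
    · rw [mem_stack_lower hm h.le] at hp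
      refine LocallyModelledAt.reparam lower continuous_lower half continuous_half
        {t | (t : ℝ) < 1 / 2} {t | (t : ℝ) < 1}
        (isOpen_lt continuous_subtype_val continuous_const)
        (isOpen_lt continuous_subtype_val continuous_const) ?_ ?_ ?_ ?_ ?_ h (S.flat _ hp)
      · intro t (ht : (t : ℝ) < 1 / 2)
        show (lower t : ℝ) < 1
        rw [coe_lower ht.le]; linarith
      · intro t (ht : (t : ℝ) < 1)
        show (half t : ℝ) < 1 / 2
        rw [coe_half]; linarith
      · intro t (ht : (t : ℝ) < 1 / 2)
        exact half_lower ht.le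
      · intro t _
        exact lower_half t
      · intro z t (ht : (t : ℝ) < 1 / 2)
        exact mem_stack_lower hm ht.le
    · obtain ⟨ε, hε, -, h1⟩ := S.collar
      obtain ⟨δ, hδ, h0, -⟩ := S'.collar
      have key : ∀ x : Cylinder, 1 / 2 - ε / 2 < (x.2 : ℝ) → (x.2 : ℝ) < 1 / 2 + δ / 2 →
          (x ∈ stack S.carrier S'.carrier ↔ x ∈ O'.carrier ×ˢ (univ : Set unitInterval)) := by
        intro x hx hx'
        rcases le_total (x.2 : ℝ) (1 / 2) with hh | hh
        · rw [mem_stack_lower hm hh, h1 _ _ (by rw [coe_lower hh]; linarith)]; simp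
        · rw [mem_stack_upper hm hh, h0 _ _ (by rw [coe_upper hh]; linarith)]; simp
      have c : Continuous fun p : Cylinder => (p.2 : ℝ) := by fun_prop
      refine LocallyModelledAt.congr
        {x | 1 / 2 - ε / 2 < (x.2 : ℝ) ∧ (x.2 : ℝ) < 1 / 2 + δ / 2}
        ((isOpen_lt continuous_const c).inter (isOpen_lt c continuous_const))
        ⟨by linarith, by linarith⟩ (fun x hx => key x hx.1 hx.2)
        (LocallyModelledAt.prod_univ (O'.flat _ ?_))
      exact ((key p (by linarith) (by linarith)).1 hp).1
    · rw [mem_stack_upper hm h.le] at hp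
      refine LocallyModelledAt.reparam upper continuous_upper halfUp continuous_halfUp
        {t | 1 / 2 < (t : ℝ)} {t | 0 < (t : ℝ)}
        (isOpen_lt continuous_const continuous_subtype_val)
        (isOpen_lt continuous_const continuous_subtype_val) ?_ ?_ ?_ ?_ ?_ h (S'.flat _ hp)
      · intro t (ht : 1 / 2 < (t : ℝ))
        show 0 < (upper t : ℝ)
        rw [coe_upper ht.le]; linarith
      · intro t (ht : 0 < (t : ℝ))
        show 1 / 2 < (halfUp t : ℝ)
        rw [coe_halfUp]; linarith
      · intro t (ht : 1 / 2 < (t : ℝ))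
        exact halfUp_upper ht.le
      · intro t _
        exact upper_halfUp t
      · intro z t (ht : 1 / 2 < (t : ℝ))
        exact mem_stack_upper hm ht.le
  side z t := by
    have hm := S.fits S'
    rcases le_total (t : ℝ) (1 / 2) with h | h
    · rw [mem_stack_lower hm h, S.side]
    · rw [mem_stack_upper hm h, S'.side]
  collar := by
    have hm := S.fits S'
    obtain ⟨ε, hε, h0, -⟩ := S.collar
    obtain ⟨δ, hδ, -, h1⟩ := S'.collar
    refine ⟨min (1 / 2) (min (ε / 2) (δ / 2)), by positivity, fun z t ht => ?_, fun z t ht => ?_⟩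
    · have hl : (t : ℝ) ≤ 1 / 2 := ht.trans (min_le_left _ _)
      have hl' : (t : ℝ) ≤ ε / 2 := ht.trans ((min_le_right _ _).trans (min_le_left _ _))
      rw [mem_stack_lower hm hl, h0 _ _ (by rw [coe_lower hl]; linarith)]
    · have a1 := min_le_left (1 / 2) (min (ε / 2) (δ / 2))
      have a2 := (min_le_right (1 / 2) (min (ε / 2) (δ / 2))).trans (min_le_right _ _)
      have hl : 1 / 2 ≤ (t : ℝ) := by linarith
      rw [mem_stack_upper hm hl, h1 _ _ (by rw [coe_upper hl]; linarith)]

/-- Cobordisms up to boundary preserving isotopy. -/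
instance setoid (O O' : Smoothing B) : Setoid (Cobordism O O') where
  r S S' := Isotopic S.carrier S'.carrier
  iseqv := ⟨fun _ => Isotopic.refl _, Isotopic.symm, Isotopic.trans⟩

lemma comp_congr {S₁ S₂ : Cobordism O O'} {S₁' S₂' : Cobordism O' O''} (h : S₁ ≈ S₂)
    (h' : S₁' ≈ S₂') : S₁.comp S₁' ≈ S₂.comp S₂' :=
  Isotopic.stack (S₁.fits S₁') (S₂.fits S₂') h h'

lemma refl_comp (S : Cobordism O O') : (refl O).comp S ≈ S := by
  refine Isotopic.symm ?_
  obtain ⟨ε', hε', hc, -⟩ := S.collar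
  obtain ⟨ε, hε, h1, hle⟩ : ∃ ε : ℝ, 0 < ε ∧ ε ≤ 1 ∧ ε ≤ ε' :=
    ⟨min ε' 1, by positivity, min_le_right _ _, min_le_left _ _⟩
  have hk : (1 + ε) / (2 * ε) * ε = (1 + ε) / 2 := by field_simp
  have hk1 : 1 ≤ (1 + ε) / (2 * ε) := by rw [le_div_iff₀ (by positivity)]; linarith
  set k := (1 + ε) / (2 * ε) with hkdef
  let f : unitInterval → unitInterval := fun t => ⟨min (k * t) ((1 + t) / 2), by
    have h0 := t.2.1; have h1 := t.2.2
    exact ⟨le_min (by positivity) (by linarith), (min_le_right _ _).trans (by linarith)⟩⟩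
  have fc : ∀ t, (f t : ℝ) = min (k * t) ((1 + t) / 2) := fun _ => rfl
  refine Isotopic.of_reparam f (by fun_prop) ?_ ?_ ?_ ?_
  · intro a b hab
    have hab : (a : ℝ) < b := hab
    show min (k * a) ((1 + (a : ℝ)) / 2) < min (k * b) ((1 + (b : ℝ)) / 2)
    exact min_lt_min (by nlinarith) (by linarith)
  · ext; simp [f]
  · ext; simp only [fc]; norm_num; exact hk1
  · intro z t
    have hm := (refl O).fits S
    show (z, f t) ∈ stack (refl O).carrier S.carrier ↔ _
    have hr : (f t : ℝ) ≤ (1 + t) / 2 := min_le_right _ _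
    rcases le_total (t : ℝ) ε with h | h
    · rw [hc z t (h.trans hle)]
      rcases le_total (f t : ℝ) (1 / 2) with h' | h'
      · rw [mem_stack_lower hm h']; simp [refl]
      · rw [mem_stack_upper hm h', hc]
        rw [coe_upper h']; linarith
    · have e : (f t : ℝ) = (1 + t) / 2 := by
        rw [fc, min_eq_right]; nlinarith
      have h' : 1 / 2 ≤ (f t : ℝ) := by rw [e]; linarith
      rw [mem_stack_upper hm h']
      have : upper (f t) = t := by ext; rw [coe_upper h', e]; ring
      simp only [this]

lemma comp_refl (S : Cobordism O O') : S.comp (refl O') ≈ S := by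
  refine Isotopic.symm ?_
  obtain ⟨ε', hε', -, hc⟩ := S.collar
  obtain ⟨ε, hε, h1, hle⟩ : ∃ ε : ℝ, 0 < ε ∧ ε ≤ 1 ∧ ε ≤ ε' :=
    ⟨min ε' 1, by positivity, min_le_right _ _, min_le_left _ _⟩
  have hk : (1 + ε) / (2 * ε) * ε = (1 + ε) / 2 := by field_simp
  have hk1 : 1 ≤ (1 + ε) / (2 * ε) := by rw [le_div_iff₀ (by positivity)]; linarith
  set k := (1 + ε) / (2 * ε) with hkdef
  let f : unitInterval → unitInterval := fun t => ⟨max (1 - k * (1 - t)) (t / 2), by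
    have h0 := t.2.1; have h1 := t.2.2
    have : 0 ≤ k * (1 - t) := mul_nonneg (by linarith) (by linarith)
    exact ⟨le_max_of_le_right (by positivity), max_le (by linarith) (by linarith)⟩⟩
  have fc : ∀ t, (f t : ℝ) = max (1 - k * (1 - t)) (t / 2) := fun _ => rfl
  refine Isotopic.of_reparam f (by fun_prop) ?_ ?_ ?_ ?_
  · intro a b hab
    have hab : (a : ℝ) < b := hab
    show max (1 - k * (1 - (a : ℝ))) (a / 2) < max (1 - k * (1 - (b : ℝ))) (b / 2)
    exact max_lt_max (by nlinarith) (by linarith)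
  · ext; simp only [fc]; norm_num; exact hk1
  · ext; simp only [fc]; norm_num
  · intro z t
    have hm := S.fits (refl O')
    show (z, f t) ∈ stack S.carrier (refl O').carrier ↔ _
    have hr : (t : ℝ) / 2 ≤ (f t : ℝ) := le_max_right _ _
    rcases le_total (1 - ε) (t : ℝ) with h | h
    · rw [hc z t (by linarith)]
      rcases le_total (f t : ℝ) (1 / 2) with h' | h'
      · rw [mem_stack_lower hm h', hc]
        rw [coe_lower h']; linarith
      · rw [mem_stack_upper hm h']; simp [refl]
    · have e : (f t : ℝ) = t / 2 := by
        rw [fc, max_eq_right]; nlinarith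
      have h' : (f t : ℝ) ≤ 1 / 2 := by rw [e]; linarith [t.2.2]
      rw [mem_stack_lower hm h']
      have : lower (f t) = t := by ext; rw [coe_lower h', e]; ring
      simp only [this]

lemma comp_assoc (S₁ : Cobordism O O') (S₂ : Cobordism O' O'') (S₃ : Cobordism O'' Q) :
    (S₁.comp S₂).comp S₃ ≈ S₁.comp (S₂.comp S₃) := by
  refine Isotopic.symm ?_
  let f : unitInterval → unitInterval := fun t => ⟨max (t / 2) (max (t - 1 / 4) (2 * t - 1)), by
    have h0 := t.2.1; have h1 := t.2.2
    exact ⟨le_max_of_le_left (by positivity),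
      max_le (by linarith) (max_le (by linarith) (by linarith))⟩⟩
  have fc : ∀ t, (f t : ℝ) = max ((t : ℝ) / 2) (max ((t : ℝ) - 1 / 4) (2 * t - 1)) := fun _ => rfl
  refine Isotopic.of_reparam f (by fun_prop) ?_ ?_ ?_ ?_
  · intro a b hab
    have hab : (a : ℝ) < b := hab
    show (f a : ℝ) < f b
    rw [fc, fc]
    exact max_lt_max (by linarith) (max_lt_max (by linarith) (by linarith))
  · ext; simp only [fc]; norm_num
  · ext; simp only [fc]; norm_num
  · intro z t
    have hm := (S₁.comp S₂).fits S₃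
    have hm' := S₁.fits (S₂.comp S₃)
    show (z, f t) ∈ stack (S₁.comp S₂).carrier S₃.carrier ↔
      (z, t) ∈ stack S₁.carrier (S₂.comp S₃).carrier
    rcases le_total (t : ℝ) (1 / 2) with h | h
    · have e : (f t : ℝ) = t / 2 := by
        rw [fc, max_eq_left]; exact max_le (by linarith) (by linarith)
      have h' : (f t : ℝ) ≤ 1 / 2 := by rw [e]; linarith
      have h'' : lower (f t) = t := by ext; rw [coe_lower h', e]; ring
      rw [mem_stack_lower hm h', mem_stack_lower hm' h]
      simp only [h'']
      exact mem_stack_lower (S₁.fits S₂) h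
    · rw [mem_stack_upper hm' h]
      rcases le_total (t : ℝ) (3 / 4) with k | k
      · have e : (f t : ℝ) = t - 1 / 4 := by
          rw [fc, max_eq_right, max_eq_left]
          · linarith
          · exact le_max_of_le_left (by linarith)
        have h' : (f t : ℝ) ≤ 1 / 2 := by rw [e]; linarith
        have u' : 1 / 2 ≤ (lower (f t) : ℝ) := by rw [coe_lower h', e]; linarith
        have u'' : (upper t : ℝ) ≤ 1 / 2 := by rw [coe_upper h]; linarith
        rw [mem_stack_lower hm h']
        refine (mem_stack_upper (S₁.fits S₂) u').trans
          (Iff.trans ?_ (mem_stack_lower (S₂.fits S₃) u'').symm)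
        have : upper (lower (f t)) = lower (upper t) := by
          ext; rw [coe_upper u', coe_lower u'', coe_lower h', coe_upper h, e]; ring
        simp only [this]
      · have e : (f t : ℝ) = 2 * t - 1 := by
          rw [fc, max_eq_right, max_eq_right]
          · linarith
          · exact le_max_of_le_right (by linarith)
        have h' : 1 / 2 ≤ (f t : ℝ) := by rw [e]; linarith
        have u'' : 1 / 2 ≤ (upper t : ℝ) := by rw [coe_upper h]; linarith
        rw [mem_stack_upper hm h']
        refine Iff.trans ?_ (mem_stack_upper (S₂.fits S₃) u'').symm
        have : f t = upper t := by ext; rw [coe_upper h, e]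
        simp only [this]

end Cobordism

/-- The category `Cob(B)`: its objects are the smoothings with boundary `B`. -/
abbrev Cob (B : Finset Circle) : Type := Smoothing B

/-- Morphisms of `Cob(B)` are cobordisms up to boundary preserving isotopy; `f ≫ g` is `g` placed
on top of `f`. -/
instance (B : Finset Circle) : Category (Cob B) where
  Hom O O' := Quotient (Cobordism.setoid O O')
  id O := Quotient.mk _ (Cobordism.refl O)
  comp f g := Quotient.map₂ Cobordism.comp
    (fun _ _ h _ _ h' => Cobordism.comp_congr h h') f g
  id_comp f := Quotient.inductionOn f fun S => Quotient.sound S.refl_comp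
  comp_id f := Quotient.inductionOn f fun S => Quotient.sound S.comp_refl
  assoc f g h := Quotient.inductionOn₃ f g h fun S₁ S₂ S₃ => Quotient.sound (S₁.comp_assoc S₂ S₃)

/-! ### Charts -/

lemma exists_chart {E : Type} [NormedAddCommGroup E] [NormedSpace ℝ E] [FiniteDimensional ℝ E]
    (f : E → ℝ) (f' l : E →L[ℝ] ℝ) (a b : E) (hf : HasStrictFDerivAt f f' a) (hf' : f' ≠ 0)
    (hl : l ≠ 0) (ha : f a = 0) (hb : l b = 0) :
    ∃ e : OpenPartialHomeomorph E E, a ∈ e.source ∧ e a = b ∧ ∀ x ∈ e.source, f x = l (e x) := by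
  have : CompleteSpace E := FiniteDimensional.complete ℝ E
  obtain ⟨u, hu⟩ : ∃ u, l u = 1 := by
    obtain ⟨v, hv⟩ := DFunLike.ne_iff.1 hl
    have hv : l v ≠ 0 := hv
    exact ⟨(l v)⁻¹ • v, by simp [hv]⟩
  obtain ⟨v, hv⟩ : ∃ v, f' v = 1 := by
    obtain ⟨v, hv⟩ := DFunLike.ne_iff.1 hf'
    have hv : f' v ≠ 0 := hv
    exact ⟨(f' v)⁻¹ • v, by simp [hv]⟩
  have hl0 : (l : E →ₗ[ℝ] ℝ) ≠ 0 := fun h => hl (by ext x; simpa using LinearMap.congr_fun h x)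
  have hf0 : (f' : E →ₗ[ℝ] ℝ) ≠ 0 := fun h => hf' (by ext x; simpa using LinearMap.congr_fun h x)
  have hrank : Module.finrank ℝ (LinearMap.ker (f' : E →ₗ[ℝ] ℝ)) =
      Module.finrank ℝ (LinearMap.ker (l : E →ₗ[ℝ] ℝ)) := by
    have h1 := Module.Dual.finrank_ker_add_one_of_ne_zero hl0
    have h2 := Module.Dual.finrank_ker_add_one_of_ne_zero hf0
    omega
  let K := LinearEquiv.ofFinrankEq _ _ hrank
  let P : E →ₗ[ℝ] LinearMap.ker (f' : E →ₗ[ℝ] ℝ) :=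
    LinearMap.codRestrict _ (LinearMap.id - (f' : E →ₗ[ℝ] ℝ).smulRight v) (by simp [hv])
  let A₀ : E →ₗ[ℝ] E :=
    (Submodule.subtype _) ∘ₗ K.toLinearMap ∘ₗ P + (f' : E →ₗ[ℝ] ℝ).smulRight u
  have hA₀ : ∀ x, l (A₀ x) = f' x := by
    intro x
    have : l (K (P x)) = 0 := (K (P x)).2
    simp [A₀, this, hu]
  have hinj : Function.Injective A₀ := by
    rw [← LinearMap.ker_eq_bot, LinearMap.ker_eq_bot']
    intro x hx
    have h1 : f' x = 0 := by rw [← hA₀, hx, map_zero]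
    have h2 : K (P x) = 0 := by
      ext
      simpa [A₀, h1] using hx
    have h3 : P x = 0 := by simpa using h2
    have h4 : x - f' x • v = 0 := congrArg Subtype.val h3
    simpa [h1] using h4
  let A : E ≃L[ℝ] E := (LinearEquiv.ofInjectiveEndo A₀ hinj).toContinuousLinearEquiv
  have hA : ∀ x, l (A x) = f' x := hA₀
  let φ : E → E := fun x => A (x - a) + (f x - f' (x - a)) • u + b
  have hφ : HasStrictFDerivAt φ (A : E →L[ℝ] E) a := by
    have h1 : HasStrictFDerivAt (fun x => x - a) (ContinuousLinearMap.id ℝ E) a :=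
      (hasStrictFDerivAt_id a).sub_const a
    have h2 := (A : E →L[ℝ] E).hasStrictFDerivAt.comp a h1
    have h3 := f'.hasStrictFDerivAt.comp a h1
    have h4 := (h2.add ((hf.sub h3).smul_const u)).add_const b
    refine h4.congr_fderiv ?_
    ext x; simp
  refine ⟨hφ.toOpenPartialHomeomorph φ, hφ.mem_toOpenPartialHomeomorph_source, ?_, fun x _ => ?_⟩
  · rw [hφ.toOpenPartialHomeomorph_coe]; simp [φ, ha]
  · rw [hφ.toOpenPartialHomeomorph_coe]; simp [φ, hA, hu, hb]

/-- The inclusion of the open disk in the plane. -/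
def diskChart : OpenPartialHomeomorph Disk ℂ where
  toFun := (↑)
  invFun z := if h : ‖z‖ ≤ 1 then ⟨z, by simpa using h⟩ else ⟨0, by simp⟩
  source := {z | ‖(z : ℂ)‖ < 1}
  target := {z | ‖z‖ < 1}
  map_source' _ h := h
  map_target' z h := by
    have h : ‖z‖ < 1 := h
    simpa [h.le] using h
  left_inv' z h := by
    have h : ‖(z : ℂ)‖ < 1 := h
    simp [h.le]
  right_inv' z h := by
    have h : ‖z‖ < 1 := h
    simp [h.le]
  open_source := isOpen_lt (by fun_prop) continuous_const
  open_target := isOpen_lt (by fun_prop) continuous_const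
  continuousOn_toFun := continuous_subtype_val.continuousOn
  continuousOn_invFun := by
    rw [Topology.IsInducing.subtypeVal.continuousOn_iff]
    refine continuousOn_id.congr fun z h => ?_
    have h : ‖z‖ < 1 := h
    simp [h.le]

/-- The inclusion of the open unit interval in the line. -/
def intervalChart : OpenPartialHomeomorph unitInterval ℝ where
  toFun := (↑)
  invFun := projIcc 0 1 zero_le_one
  source := {t | (t : ℝ) ∈ Ioo 0 1}
  target := Ioo 0 1
  map_source' _ h := h
  map_target' t h := by
    have : (projIcc (0 : ℝ) 1 zero_le_one t : ℝ) = t := by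
      rw [projIcc_of_mem _ (Ioo_subset_Icc_self h)]
    show (projIcc (0 : ℝ) 1 zero_le_one t : ℝ) ∈ Ioo (0 : ℝ) 1
    rwa [this]
  left_inv' t _ := by simp
  right_inv' t h := by rw [projIcc_of_mem _ (Ioo_subset_Icc_self h)]
  open_source := isOpen_Ioo.preimage continuous_subtype_val
  open_target := isOpen_Ioo
  continuousOn_toFun := continuous_subtype_val.continuousOn
  continuousOn_invFun := continuous_projIcc.continuousOn

/-! ### The local model of a crossing and of a saddle -/

/-- A continuously differentiable function vanishing on the negative half line. -/
def ramp (x : ℝ) : ℝ := max x 0 ^ 2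

lemma ramp_of_nonpos {x : ℝ} (h : x ≤ 0) : ramp x = 0 := by simp [ramp, h]

lemma ramp_of_nonneg {x : ℝ} (h : 0 ≤ x) : ramp x = x ^ 2 := by simp [ramp, h]

lemma hasDerivAt_ramp (x : ℝ) : HasDerivAt ramp (2 * max x 0) x := by
  rcases lt_trichotomy x 0 with h | h | h
  · rw [max_eq_right h.le, mul_zero]
    refine (hasDerivAt_const x (0 : ℝ)).congr_of_eventuallyEq ?_
    filter_upwards [Iio_mem_nhds h] with y hy using ramp_of_nonpos (le_of_lt hy)
  · subst h
    have : HasFDerivAt ramp (0 : ℝ →L[ℝ] ℝ) 0 := by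
      refine Asymptotics.IsBigO.hasFDerivAt (n := 2) ?_ (by norm_num)
      refine Asymptotics.IsBigO.of_bound 1 (Filter.Eventually.of_forall fun y => ?_)
      rcases le_total y 0 with hy | hy
      · rw [ramp_of_nonpos hy]; simp; positivity
      · rw [ramp_of_nonneg hy]; simp
    simpa using this.hasDerivAt
  · rw [max_eq_left h.le]
    have := (hasDerivAt_pow 2 x).congr_of_eventuallyEq (f₁ := ramp) (by
      filter_upwards [Ioi_mem_nhds h] with y hy using ramp_of_nonneg (le_of_lt hy))
    simpa using this

lemma hasStrictDerivAt_ramp (x : ℝ) : HasStrictDerivAt ramp (2 * max x 0) x :=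
  hasStrictDerivAt_of_hasDerivAt_of_continuousAt
    (Filter.Eventually.of_forall hasDerivAt_ramp) (by fun_prop)

/-- A radial function on the plane, positive on the open unit disk and zero outside it. -/
def bump (z : ℂ) : ℝ := ramp (1 - (z.re ^ 2 + z.im ^ 2))

lemma bump_of_one_le {z : ℂ} (h : 1 ≤ ‖z‖) : bump z = 0 := by
  refine ramp_of_nonpos ?_
  have := Complex.sq_norm z
  rw [Complex.normSq_apply] at this
  nlinarith

/-- The parameter of the two smoothings of a crossing. -/
def level (b : Bool) : ℝ := if b then 1 / 8 else -1 / 8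

/-- The parameter of the level sets of a saddle: it increases from the parameter of the
`0`-smoothing to that of the `1`-smoothing, being constant for `t ≤ 1/4` and for `t ≥ 3/4`, and it
vanishes, with non-zero derivative, at `t = 1/2` only. -/
def saddleLevel (t : ℝ) : ℝ :=
  (ramp (4 * t - 1) - 2 * ramp (4 * t - 2) + ramp (4 * t - 3) - 1) / 8

lemma saddleLevel_of_le {t : ℝ} (h : t ≤ 1 / 4) : saddleLevel t = level false := by
  rw [saddleLevel, ramp_of_nonpos, ramp_of_nonpos, ramp_of_nonpos] <;> try linarith
  norm_num [level]

lemma saddleLevel_of_ge {t : ℝ} (h : 3 / 4 ≤ t) : saddleLevel t = level true := by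
  rw [saddleLevel, ramp_of_nonneg, ramp_of_nonneg, ramp_of_nonneg] <;> try linarith
  simp only [level]; norm_num; ring

lemma abs_saddleLevel_le (t : ℝ) : |saddleLevel t| ≤ 1 / 8 := by
  rw [abs_le]
  rcases le_total t (1 / 4) with h | h
  · rw [saddleLevel_of_le h]; norm_num [level]
  rcases le_total (3 / 4) t with h' | h'
  · rw [saddleLevel_of_ge h']; norm_num [level]
  rcases le_total t (1 / 2) with k | k
  · rw [saddleLevel, ramp_of_nonneg, ramp_of_nonpos, ramp_of_nonpos] <;> try linarith
    constructor <;> nlinarith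
  · rw [saddleLevel, ramp_of_nonneg, ramp_of_nonneg, ramp_of_nonpos] <;> try linarith
    constructor <;> nlinarith

lemma eq_half_of_saddleLevel_eq_zero {t : ℝ} (h0 : saddleLevel t = 0) : t = 1 / 2 := by
  rcases le_total t (1 / 4) with h | h
  · rw [saddleLevel_of_le h] at h0; norm_num [level] at h0
  rcases le_total (3 / 4) t with h' | h'
  · rw [saddleLevel_of_ge h'] at h0; norm_num [level] at h0
  rcases le_total t (1 / 2) with k | k
  · rw [saddleLevel, ramp_of_nonneg, ramp_of_nonpos, ramp_of_nonpos] at h0 <;> try linarith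
    nlinarith
  · rw [saddleLevel, ramp_of_nonneg, ramp_of_nonneg, ramp_of_nonpos] at h0 <;> try linarith
    nlinarith

lemma hasStrictDerivAt_saddleLevel (t : ℝ) : HasStrictDerivAt saddleLevel
    ((2 * max (4 * t - 1) 0 * 4 - 2 * (2 * max (4 * t - 2) 0 * 4) + 2 * max (4 * t - 3) 0 * 4) / 8)
    t := by
  have h (c : ℝ) : HasStrictDerivAt (fun t : ℝ => ramp (4 * t - c)) (2 * max (4 * t - c) 0 * 4) t := by
    have h1 : HasStrictDerivAt (fun t : ℝ => 4 * t - c) 4 t := by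
      have := ((hasStrictDerivAt_id t).const_mul (4 : ℝ)).sub_const c
      rw [mul_one] at this
      exact this
    exact (hasStrictDerivAt_ramp _).comp t h1
  have := HasStrictDerivAt.div_const ((((h 1).sub ((h 2).const_mul 2)).add (h 3)).sub_const 1) 8
  exact this

/-- A height-dependent parameter whose level sets sweep out an embedded surface. -/
def Admissible (F : ℝ → ℝ) : Prop :=
  ∀ t, |F t| ≤ 1 / 8 ∧ ∃ F', HasStrictDerivAt F F' t ∧ (F t = 0 → F' ≠ 0)

lemma admissible_saddleLevel : Admissible saddleLevel := fun t =>
  ⟨abs_saddleLevel_le t, _, hasStrictDerivAt_saddleLevel t, fun h => by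
    rw [eq_half_of_saddleLevel_eq_zero h]; norm_num⟩

lemma admissible_level (b : Bool) : Admissible fun _ => level b := fun t =>
  ⟨by cases b <;> norm_num [level, abs_le], 0, hasStrictDerivAt_const t _, fun h => by
    cases b <;> norm_num [level] at h⟩

lemma hasStrictFDerivAt_crossing (F : ℝ → ℝ) (hF : Admissible F) (p : ℂ × ℝ)
    (hp : p.1.re * p.1.im = F p.2 * bump p.1) :
    ∃ G : ℂ × ℝ →L[ℝ] ℝ,
      HasStrictFDerivAt (fun q : ℂ × ℝ => q.1.re * q.1.im - F q.2 * bump q.1) G p ∧ G ≠ 0 ∧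
      (F p.2 ≠ 0 → G ∘L ContinuousLinearMap.inl ℝ ℂ ℝ ≠ 0) := by
  obtain ⟨z, t⟩ := p
  obtain ⟨habs, F', hF', hne⟩ := hF t
  have hx : HasStrictFDerivAt (fun q : ℂ × ℝ => q.1.re)
      (Complex.reCLM ∘L ContinuousLinearMap.fst ℝ ℂ ℝ) (z, t) :=
    (Complex.reCLM ∘L ContinuousLinearMap.fst ℝ ℂ ℝ).hasStrictFDerivAt
  have hy : HasStrictFDerivAt (fun q : ℂ × ℝ => q.1.im)
      (Complex.imCLM ∘L ContinuousLinearMap.fst ℝ ℂ ℝ) (z, t) :=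
    (Complex.imCLM ∘L ContinuousLinearMap.fst ℝ ℂ ℝ).hasStrictFDerivAt
  have ht : HasStrictFDerivAt (fun q : ℂ × ℝ => q.2)
      (ContinuousLinearMap.snd ℝ ℂ ℝ) (z, t) :=
    (ContinuousLinearMap.snd ℝ ℂ ℝ).hasStrictFDerivAt
  have hb := (hasStrictDerivAt_ramp (1 - (z.re ^ 2 + z.im ^ 2))).comp_hasStrictFDerivAt (z, t)
    (f := fun q : ℂ × ℝ => 1 - (q.1.re ^ 2 + q.1.im ^ 2)) (((hx.pow 2).add (hy.pow 2)).const_sub 1)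
  have hFt := hF'.comp_hasStrictFDerivAt (z, t) (f := fun q : ℂ × ℝ => q.2) ht
  have hG := (hx.mul hy).sub (hFt.mul hb)
  set g := 2 * max (1 - (z.re ^ 2 + z.im ^ 2)) 0 with hg
  have hg0 : 0 ≤ g := by positivity
  have hg2 : g ≤ 2 := by
    have : max (1 - (z.re ^ 2 + z.im ^ 2)) 0 ≤ 1 := max_le (by nlinarith [sq_nonneg z.re, sq_nonneg z.im]) (by norm_num)
    linarith
  have spatial : (∀ w : ℂ, z.re * w.im + z.im * w.re + F t * g * 2 * (z.re * w.re + z.im * w.im) = 0)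
      → F t = 0 ∧ bump z = 1 := by
    intro h
    have h1 := h 1
    have h2 := h Complex.I
    simp at h1 h2
    have hc : |F t * g * 2| ≤ 1 / 2 := by
      rw [abs_mul, abs_mul, abs_of_nonneg hg0, abs_two]
      nlinarith [abs_nonneg (F t)]
    set c := F t * g * 2 with hcdef
    have hc2 : c ^ 2 ≤ 1 / 4 := by
      rw [← sq_abs]; nlinarith [abs_nonneg c]
    have e1 : z.im = -(c * z.re) := by linarith
    have e2 : z.re * (1 - c ^ 2) = 0 := by rw [e1] at h2; linarith
    have e3 : z.re = 0 := by
      rcases mul_eq_zero.1 e2 with h | h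
      · exact h
      · nlinarith
    have e4 : z.im = 0 := by rw [e1, e3]; ring
    have e5 : bump z = 1 := by simp [bump, e3, e4, ramp]
    refine ⟨?_, e5⟩
    have : z.re * z.im = F t * bump z := hp
    rw [e3, e5] at this
    linarith
  refine ⟨_, hG, ?_, ?_⟩
  · intro h0
    have hval : ∀ w : ℂ × ℝ, z.re * w.1.im + z.im * w.1.re
        + F t * g * 2 * (z.re * w.1.re + z.im * w.1.im) - bump z * F' * w.2 = 0 := by
      intro w
      have := DFunLike.congr_fun h0 w
      simp at this
      rw [← this]
      simp only [bump]
      ring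
    obtain ⟨hF0, hb1⟩ := spatial fun w => by simpa using hval (w, 0)
    have := hval (0, 1)
    rw [hb1] at this
    simp at this
    exact hne hF0 this
  · intro hFne h0
    refine hFne (spatial fun w => ?_).1
    have := DFunLike.congr_fun h0 w
    simp at this
    rw [← this]
    ring

lemma flat_curve_chart (χ : ℂ → Disk) (hχ : Topology.IsOpenEmbedding χ) (S : Set Disk) (b : Bool)
    (hS : ∀ z, χ z ∈ S ↔ z.re * z.im = level b * bump z) (z : ℂ) (hz : χ z ∈ S) :
    LocallyModelledAt diameter S (χ z) := by
  have hz' := (hS z).1 hz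
  obtain ⟨G, hG, -, hne⟩ := hasStrictFDerivAt_crossing _ (admissible_level b) (z, 0) hz'
  have hG' := hG.comp z (f := fun w : ℂ => (w, (0 : ℝ))) (ContinuousLinearMap.inl ℝ ℂ ℝ).hasStrictFDerivAt
  have hne' := hne (by cases b <;> norm_num [level])
  obtain ⟨e, he, hea, hs⟩ := exists_chart _ _ Complex.imCLM z 0 hG' hne'
    (fun h => by simpa using DFunLike.congr_fun h Complex.I) (by simp [hz']) (by simp)
  refine ⟨((hχ.toOpenPartialHomeomorph χ).symm.trans e).trans diskChart.symm, ?_, ?_⟩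
  · have hw0 : (hχ.toOpenPartialHomeomorph χ).symm (χ z) = z :=
      (hχ.toOpenPartialHomeomorph χ).left_inv (by simp)
    simp [he, hea, hw0, diskChart]
  · intro x hx
    simp only [OpenPartialHomeomorph.trans_source, OpenPartialHomeomorph.symm_source, mem_inter_iff,
      mem_preimage] at hx
    obtain ⟨⟨hx1, hx2⟩, hx3⟩ := hx
    obtain ⟨w, rfl⟩ : x ∈ range χ := by simpa using hx1
    have hw : (hχ.toOpenPartialHomeomorph χ).symm (χ w) = w :=
      (hχ.toOpenPartialHomeomorph χ).left_inv (by simp)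
    rw [hw] at hx2
    simp only [OpenPartialHomeomorph.coe_trans, Function.comp_apply, hw] at hx3 ⊢
    have hd : ((diskChart.symm (e w) : Disk) : ℂ) = e w := diskChart.right_inv hx3
    rw [hS, diameter, mem_ofPred_eq, hd]
    have := hs w hx2
    simp at this
    rw [← this, sub_eq_zero]

lemma flat_surface_chart (χ : ℂ → Disk) (hχ : Topology.IsOpenEmbedding χ) (S : Set Cylinder)
    (F : ℝ → ℝ) (hF : Admissible F)
    (hS : ∀ z (t : unitInterval), (χ z, t) ∈ S ↔ z.re * z.im = F t * bump z)
    (z : ℂ) (t : unitInterval) (ht : (t : ℝ) ∈ Ioo 0 1) (hz : (χ z, t) ∈ S) :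
    LocallyModelledAt (diameter ×ˢ (univ : Set unitInterval)) S (χ z, t) := by
  have hz' := (hS z t).1 hz
  obtain ⟨G, hG, hne, -⟩ := hasStrictFDerivAt_crossing F hF (z, t) hz'
  obtain ⟨e, he, hea, hs⟩ := exists_chart _ _ (Complex.imCLM ∘L ContinuousLinearMap.fst ℝ ℂ ℝ)
    (z, (t : ℝ)) (0, 1 / 2) hG hne
    (fun h => by simpa using DFunLike.congr_fun h (Complex.I, 0)) (by simp [hz']) (by simp)
  refine ⟨(((hχ.toOpenPartialHomeomorph χ).symm.prod intervalChart).trans e).trans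
    (diskChart.prod intervalChart).symm, ?_, ?_⟩
  · have h1 : intervalChart t = (t : ℝ) := rfl
    have h2 : t ∈ intervalChart.source := ht
    have h3 : (0 : ℂ) ∈ diskChart.target := by simp [diskChart]
    have h4 : (1 / 2 : ℝ) ∈ intervalChart.target := by
      show (1 / 2 : ℝ) ∈ Ioo (0 : ℝ) 1
      norm_num
    have h4' : (2⁻¹ : ℝ) ∈ intervalChart.target := by simpa using h4
    have hw0 : (hχ.toOpenPartialHomeomorph χ).symm (χ z) = z :=
      (hχ.toOpenPartialHomeomorph χ).left_inv (by simp)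
    simp [he, hea, hw0, h1, h2, h3, h4']
  · rintro ⟨x, s⟩ hx
    simp only [OpenPartialHomeomorph.trans_source, OpenPartialHomeomorph.symm_source, mem_inter_iff,
      mem_preimage] at hx
    obtain ⟨⟨hx1, hx2⟩, hx3⟩ := hx
    obtain ⟨w, rfl⟩ : x ∈ range χ := by simpa using hx1.1
    have hw : (hχ.toOpenPartialHomeomorph χ).symm (χ w) = w :=
      (hχ.toOpenPartialHomeomorph χ).left_inv (by simp)
    have hw' : ((hχ.toOpenPartialHomeomorph χ).symm.prod intervalChart) (χ w, s) = (w, (s : ℝ)) :=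
      Prod.ext hw rfl
    rw [hw'] at hx2
    simp only [OpenPartialHomeomorph.coe_trans, Function.comp_apply, hw'] at hx3 ⊢
    have hd : (((diskChart.prod intervalChart).symm (e (w, (s : ℝ)))).1 : ℂ) = (e (w, (s : ℝ))).1 :=
      diskChart.right_inv hx3.1
    have := hs _ hx2
    simp at this
    rw [hS, mem_prod, diameter, mem_ofPred_eq, hd, ← this, sub_eq_zero]
    simp

/-! ### Oriented tangle diagrams -/

/-- The oriented compact one-manifold consisting of `a` intervals and `b` circles. -/
abbrev Strands (a b : ℕ) : Type := (Fin a × unitInterval) ⊕ (Fin b × Circle)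

/-- The boundary points of `Strands a b`: the endpoints of the intervals. -/
def IsEndpoint {a b : ℕ} : Strands a b → Prop
  | Sum.inl (_, t) => t = 0 ∨ t = 1
  | Sum.inr _ => False

/-- A path running along one of the strands in the direction of its orientation. -/
def IsForward {a b : ℕ} (α : ℝ → Strands a b) : Prop :=
  (∃ (j : Fin a) (c : ℝ → unitInterval), Continuous c ∧ StrictMono c ∧
    ∀ x, α x = Sum.inl (j, c x)) ∨
  (∃ (j : Fin b) (c : ℝ → ℝ), Continuous c ∧ StrictMono c ∧
    ∀ x, α x = Sum.inr (j, Circle.exp (c x)))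

/-- An embedding `χ` of the plane preserves orientation: the image of the counterclockwise unit
circle winds once counterclockwise around `χ 0`. -/
def PreservesOrientation (χ : ℂ → Disk) : Prop :=
  ∃ θ : ℝ → ℝ, Continuous θ ∧ (∀ x, θ (x + 2 * Real.pi) = θ x + 2 * Real.pi) ∧
    ∀ x, (χ (Circle.exp x) : ℂ) - χ 0 = ‖(χ (Circle.exp x) : ℂ) - χ 0‖ * Circle.exp (θ x)

/-- An oriented tangle diagram in the disk, with numbered crossings: an oriented compact
one-manifold, immersed in the disk with its endpoints on the boundary circle, whose only
singularities are finitely many transverse double points, at each of which one of the two strands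
is marked as the upper one. -/
structure OrientedTangleDiagram where
  /-- The number of open strands. -/
  arcs : ℕ
  /-- The number of closed strands. -/
  loops : ℕ
  /-- The number `n` of crossings. -/
  n : ℕ
  curve : Strands arcs loops → Disk
  continuous_curve : Continuous curve
  norm_curve : ∀ m, ‖(curve m : ℂ)‖ = 1 ↔ IsEndpoint m
  /-- An orientation preserving coordinate system of the plane around each crossing, centred at the
  crossing. The real axis is the upper strand, which is directed to the right; the imaginary axis
  is the lower strand. -/
  chart : Fin n → ℂ → Disk
  isOpenEmbedding_chart : ∀ k, Topology.IsOpenEmbedding (chart k)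
  norm_chart : ∀ k z, ‖(chart k z : ℂ)‖ < 1
  preservesOrientation_chart : ∀ k, PreservesOrientation (chart k)
  disjoint_chart : Pairwise fun k l => Disjoint (range (chart k)) (range (chart l))
  /-- The sign of a crossing: it is positive if the lower strand is directed upwards in the chart,
  and negative if it is directed downwards. -/
  sign : Fin n → ℤˣ
  crossing : ∀ k, ∃ upperStrand lowerStrand : ℝ → Strands arcs loops,
    IsForward upperStrand ∧ IsForward lowerStrand ∧
    (∀ x : ℝ, curve (upperStrand x) = chart k x) ∧
    (∀ x : ℝ, curve (lowerStrand x) = chart k (((sign k : ℤ) * x : ℝ) * Complex.I)) ∧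
    ∀ m, curve m ∈ range (chart k) → m ∈ range upperStrand ∪ range lowerStrand
  /-- There are no double points other than the crossings. -/
  injective : ∀ m m', curve m = curve m' → m = m' ∨ ∃ k, curve m = chart k 0
  /-- Away from the crossings the diagram is a one-dimensional submanifold of the disk. -/
  flat : ∀ p ∈ range curve, (∀ k, p ≠ chart k 0) → LocallyModelledAt diameter (range curve) p

namespace OrientedTangleDiagram

variable (T : OrientedTangleDiagram)

lemma finite_boundary : {z : Circle | toDisk z ∈ range T.curve}.Finite := by
  have h1 : {m : Strands T.arcs T.loops | IsEndpoint m}.Finite := by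
    refine Set.Finite.subset (((Set.finite_univ (α := Fin T.arcs)).prod
      (Set.toFinite ({0, 1} : Set unitInterval))).image Sum.inl) ?_
    rintro (⟨j, t⟩ | m) h
    · exact ⟨(j, t), ⟨mem_univ _, h⟩, rfl⟩
    · exact h.elim
  have h2 : Function.Injective toDisk := fun x y h => by
    ext; exact congrArg (fun p : Disk => (p : ℂ)) h
  refine ((h1.image T.curve).preimage h2.injOn).subset ?_
  rintro z ⟨m, hm⟩
  exact ⟨m, (T.norm_curve m).1 (by rw [hm]; exact Circle.norm_coe z), hm⟩

/-- The set `∂T` of endpoints of `T` on the boundary circle. -/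
def boundary : Finset Circle := T.finite_boundary.toFinset

lemma mem_boundary (z : Circle) : z ∈ T.boundary ↔ toDisk z ∈ range T.curve := by
  simp [boundary]

lemma isClosed_range : IsClosed (range T.curve) :=
  (isCompact_range T.continuous_curve).isClosed

lemma chart_mem_range (k : Fin T.n) (z : ℂ) : T.chart k z ∈ range T.curve ↔ z.re * z.im = 0 := by
  obtain ⟨u, l, -, -, hu, hl, h⟩ := T.crossing k
  have inj := (T.isOpenEmbedding_chart k).injective
  constructor
  · rintro ⟨m, hm⟩
    rcases h m ⟨z, hm.symm⟩ with ⟨x, rfl⟩ | ⟨x, rfl⟩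
    · rw [hu] at hm
      rw [← inj hm]; simp
    · rw [hl] at hm
      rw [← inj hm]; simp
  · intro h0
    rcases mul_eq_zero.1 h0 with h0 | h0
    · refine ⟨l ((T.sign k : ℤ) * z.im), ?_⟩
      rw [hl]
      congr 1
      rcases Int.units_eq_one_or (T.sign k) with h1 | h1 <;>
        apply Complex.ext <;> simp [h1, h0]
    · refine ⟨u z.re, ?_⟩
      rw [hu]
      congr 1
      apply Complex.ext <;> simp [h0]

/-- The diagram with its crossings resolved: in the small disk around the `k`-th crossing it is
replaced by the curve `x y = f k * bump (x + i y)`. For `-1/8 ≤ f k < 0` this curve consists of two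
arcs, in the second and in the fourth quadrant (the `0`-smoothing); for `0 < f k ≤ 1/8` it consists
of two arcs in the first and in the third quadrant (the `1`-smoothing). -/
def resolve (f : Fin T.n → ℝ) : Set Disk :=
  {p | p ∈ range T.curve ∧ ∀ k, p ∉ T.chart k '' Metric.ball 0 1} ∪
    ⋃ k, T.chart k '' {z | ‖z‖ ≤ 1 ∧ z.re * z.im = f k * bump z}

lemma chart_eq {k l : Fin T.n} {z w : ℂ} (h : T.chart k z = T.chart l w) : k = l ∧ z = w := by
  have hk : k = l := by
    by_contra hkl
    exact Set.disjoint_left.1 (T.disjoint_chart hkl) ⟨z, rfl⟩ (h ▸ ⟨w, rfl⟩)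
  subst hk
  exact ⟨rfl, (T.isOpenEmbedding_chart k).injective h⟩

lemma chart_mem_resolve (f : Fin T.n → ℝ) (k : Fin T.n) (z : ℂ) :
    T.chart k z ∈ T.resolve f ↔ z.re * z.im = f k * bump z := by
  constructor
  · rintro (⟨h1, h2⟩ | h)
    · have : 1 ≤ ‖z‖ := by
        by_contra hz
        exact h2 k ⟨z, by simpa using hz, rfl⟩
      rw [(T.chart_mem_range k z).1 h1, bump_of_one_le this, mul_zero]
    · obtain ⟨l, w, hw, e⟩ := mem_iUnion.1 h
      obtain ⟨rfl, rfl⟩ := T.chart_eq e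
      exact hw.2
  · intro h
    rcases le_total ‖z‖ 1 with hz | hz
    · exact Or.inr (mem_iUnion.2 ⟨k, z, ⟨hz, h⟩, rfl⟩)
    · refine Or.inl ⟨?_, ?_⟩
      · rw [chart_mem_range, h, bump_of_one_le hz, mul_zero]
      · rintro l ⟨w, hw, e⟩
        obtain ⟨rfl, rfl⟩ := T.chart_eq e
        have : ‖w‖ < 1 := by simpa using hw
        linarith

lemma mem_resolve_of_notMem (f : Fin T.n → ℝ) {p : Disk}
    (hp : ∀ k, p ∉ T.chart k '' Metric.closedBall 0 1) : p ∈ T.resolve f ↔ p ∈ range T.curve := by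
  constructor
  · rintro (h | h)
    · exact h.1
    · obtain ⟨l, w, hw, e⟩ := mem_iUnion.1 h
      exact (hp l ⟨w, by simpa using hw.1, e⟩).elim
  · exact fun h => Or.inl ⟨h, fun k hk => hp k (image_mono Metric.ball_subset_closedBall hk)⟩

/-- The complement of the small disks around the crossings. -/
def outside : Set Disk := {p | ∀ k, p ∉ T.chart k '' Metric.closedBall 0 1}

lemma isOpen_outside : IsOpen T.outside := by
  have : T.outside = ⋂ k, (T.chart k '' Metric.closedBall 0 1)ᶜ := by
    ext; simp [outside]
  rw [this]
  exact isOpen_iInter_of_finite fun k => (((isCompact_closedBall 0 1).image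
    (T.isOpenEmbedding_chart k).continuous).isClosed).isOpen_compl

lemma mem_outside_or (p : Disk) : p ∈ T.outside ∨ ∃ k z, p = T.chart k z := by
  by_cases h : p ∈ T.outside
  · exact Or.inl h
  · simp only [outside, mem_ofPred_eq, not_forall, not_not] at h
    obtain ⟨k, z, -, e⟩ := h
    exact Or.inr ⟨k, z, e.symm⟩

lemma flat_outside {p : Disk} (hp : p ∈ range T.curve) (h : p ∈ T.outside) :
    LocallyModelledAt diameter (range T.curve) p :=
  T.flat p hp fun k e => h k ⟨0, by simp, e.symm⟩

lemma continuous_bump : Continuous bump := by unfold bump ramp; fun_prop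

/-- The region swept out by a family of resolutions is closed. -/
lemma isClosed_movie (F : ℝ → Fin T.n → ℝ) (hF : ∀ k, Continuous fun t => F t k) :
    IsClosed {p : Cylinder | p.1 ∈ T.resolve (F p.2)} := by
  have h : {p : Cylinder | p.1 ∈ T.resolve (F p.2)} =
      (({p : Disk | p ∈ range T.curve} ∩ ⋂ k, (T.chart k '' Metric.ball 0 1)ᶜ) ×ˢ univ) ∪
      ⋃ k, (fun q : ℂ × unitInterval => (T.chart k q.1, q.2)) ''
        ((Metric.closedBall 0 1 ×ˢ univ) ∩ {q | q.1.re * q.1.im = F q.2 k * bump q.1}) := by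
    ext ⟨p, t⟩
    simp only [resolve, mem_ofPred_eq, mem_union, mem_iUnion, mem_image, mem_prod, mem_inter_iff,
      mem_iInter, mem_compl_iff, mem_univ, and_true, Prod.mk.injEq, Prod.exists,
      mem_closedBall_zero_iff]
    refine or_congr Iff.rfl (exists_congr fun k => ⟨?_, ?_⟩)
    · rintro ⟨z, hz, e⟩
      exact ⟨z, t, hz, e, rfl⟩
    · rintro ⟨z, s, hz, e, rfl⟩
      exact ⟨z, hz, e⟩
  rw [h]
  refine IsClosed.union (IsClosed.prod (T.isClosed_range.inter
    (isClosed_iInter fun k => ?_)) isClosed_univ) (isClosed_iUnion_of_finite fun k => ?_)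
  · exact ((T.isOpenEmbedding_chart k).isOpenMap _ Metric.isOpen_ball).isClosed_compl
  · refine IsCompact.isClosed (IsCompact.image ?_ ?_)
    · refine ((isCompact_closedBall 0 1).prod isCompact_univ).inter_right (isClosed_eq ?_ ?_)
      · fun_prop
      · exact ((hF k).comp (continuous_subtype_val.comp continuous_snd)).mul
          (continuous_bump.comp continuous_fst)
    · exact ((T.isOpenEmbedding_chart k).continuous.comp continuous_fst).prodMk continuous_snd

lemma mem_resolve_side (f : Fin T.n → ℝ) (z : Circle) :
    toDisk z ∈ T.resolve f ↔ z ∈ T.boundary := by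
  rw [mem_boundary, mem_resolve_of_notMem]
  rintro k ⟨w, -, e⟩
  have := T.norm_chart k w
  rw [e] at this
  exact absurd (Circle.norm_coe z) this.ne

/-- The smoothing of `T` associated to a state: the letter `false` stands for `0`, the letter
`true` for `1`. -/
def smoothing (w : Fin T.n → Bool) : Smoothing T.boundary where
  carrier := T.resolve fun k => level (w k)
  isClosed := by
    have h := T.isClosed_movie (fun _ k => level (w k)) (fun _ => continuous_const)
    exact h.preimage (continuous_id.prodMk (continuous_const (y := (0 : unitInterval))))
  flat := by
    intro p hp
    rcases T.mem_outside_or p with h | ⟨k, z, rfl⟩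
    · exact LocallyModelledAt.congr T.outside T.isOpen_outside h
        (fun x hx => T.mem_resolve_of_notMem _ hx)
        (T.flat_outside ((T.mem_resolve_of_notMem _ h).1 hp) h)
    · exact flat_curve_chart _ (T.isOpenEmbedding_chart k) _ (w k)
        (fun z => T.chart_mem_resolve _ k z) z hp
  boundary := T.mem_resolve_side _

/-- There is an arrow of the cube from `w` to `w'`, at the `j`-th letter: `w'` is obtained from `w`
by changing the `j`-th letter from `0` to `1`. -/
def IsArrow {n : ℕ} (j : Fin n) (w w' : Fin n → Bool) : Prop :=
  w j = false ∧ w' = Function.update w j true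

/-- The sign of the arrow out of `w` at the `j`-th letter. -/
def arrowSign {n : ℕ} (j : Fin n) (w : Fin n → Bool) : ℤ :=
  (-1) ^ (Finset.univ.filter fun i => i < j ∧ w i = true).card

/-- The parameters of the level sets of the saddle at the `j`-th crossing: constant at the other
crossings. -/
def saddleFamily (w : Fin T.n → Bool) (j : Fin T.n) (t : ℝ) (k : Fin T.n) : ℝ :=
  if k = j then saddleLevel t else level (w k)

lemma admissible_saddleFamily (w : Fin T.n → Bool) (j k : Fin T.n) :
    Admissible fun t => T.saddleFamily w j t k := by
  by_cases h : k = j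
  · simpa [saddleFamily, h] using admissible_saddleLevel
  · simpa [saddleFamily, h] using admissible_level (w k)

lemma saddleFamily_of_le {w w' : Fin T.n → Bool} {j : Fin T.n} (h : IsArrow j w w') {t : ℝ}
    (ht : t ≤ 1 / 4) : T.saddleFamily w j t = fun k => level (w k) := by
  funext k
  by_cases hk : k = j
  · subst hk; simp [saddleFamily, saddleLevel_of_le ht, h.1]
  · simp [saddleFamily, hk]

lemma saddleFamily_of_ge {w w' : Fin T.n → Bool} {j : Fin T.n} (h : IsArrow j w w') {t : ℝ}
    (ht : 3 / 4 ≤ t) : T.saddleFamily w j t = fun k => level (w' k) := by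
  funext k
  rw [h.2]
  by_cases hk : k = j
  · subst hk; simp [saddleFamily, saddleLevel_of_ge ht]
  · simp [saddleFamily, hk]

/-- The cobordism attached to an arrow of the cube: the product with the interval outside the small
disk around the `j`-th crossing, and a saddle inside; its level set at height `t` is the curve of
`resolve` with parameter `saddleLevel t` at the `j`-th crossing. -/
def saddle {w w' : Fin T.n → Bool} {j : Fin T.n} (h : IsArrow j w w') :
    Cobordism (T.smoothing w) (T.smoothing w') where
  carrier := {p | p.1 ∈ T.resolve (T.saddleFamily w j p.2)}
  isClosed := T.isClosed_movie _ fun k => continuous_iff_continuousAt.2 fun t => by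
    obtain ⟨-, F', hF', -⟩ := T.admissible_saddleFamily w j k t
    exact hF'.hasDerivAt.continuousAt
  flat := by
    rintro ⟨p, t⟩ hp
    have c : Continuous fun p : Cylinder => (p.2 : ℝ) := by fun_prop
    have hp : p ∈ T.resolve (T.saddleFamily w j t) := hp
    rcases lt_or_ge (t : ℝ) (1 / 4) with ht | ht
    · rw [T.saddleFamily_of_le h ht.le] at hp
      refine LocallyModelledAt.congr {q | (q.2 : ℝ) < 1 / 4} (isOpen_lt c continuous_const) ht
        (S' := (T.smoothing w).carrier ×ˢ univ) (fun q hq => ?_)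
        (LocallyModelledAt.prod_univ ((T.smoothing w).flat p hp))
      rw [mem_ofPred_eq, T.saddleFamily_of_le h (le_of_lt hq)]
      simp [smoothing]
    rcases lt_or_ge (3 / 4) (t : ℝ) with ht' | ht'
    · rw [T.saddleFamily_of_ge h ht'.le] at hp
      refine LocallyModelledAt.congr {q | 3 / 4 < (q.2 : ℝ)} (isOpen_lt continuous_const c) ht'
        (S' := (T.smoothing w').carrier ×ˢ univ) (fun q hq => ?_)
        (LocallyModelledAt.prod_univ ((T.smoothing w').flat p hp))
      rw [mem_ofPred_eq, T.saddleFamily_of_ge h (le_of_lt hq)]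
      simp [smoothing]
    rcases T.mem_outside_or p with ho | ⟨k, z, rfl⟩
    · refine LocallyModelledAt.congr (Prod.fst ⁻¹' T.outside)
        (T.isOpen_outside.preimage continuous_fst) ho
        (S' := range T.curve ×ˢ univ) (fun q hq => ?_)
        (LocallyModelledAt.prod_univ (T.flat_outside ((T.mem_resolve_of_notMem _ ho).1 hp) ho))
      rw [mem_ofPred_eq, T.mem_resolve_of_notMem _ hq]
      simp
    · exact flat_surface_chart _ (T.isOpenEmbedding_chart k) _ _
        (T.admissible_saddleFamily w j k) (fun z s => T.chart_mem_resolve _ k z) z t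
        ⟨by linarith, by linarith⟩ hp
  side z t := T.mem_resolve_side _ z
  collar := by
    refine ⟨1 / 4, by norm_num, fun z t ht => ?_, fun z t ht => ?_⟩
    · rw [mem_ofPred_eq, T.saddleFamily_of_le h ht]; rfl
    · rw [mem_ofPred_eq, T.saddleFamily_of_ge h (by linarith)]; rfl

end OrientedTangleDiagram

/-! ### Complexes and the Khovanov bracket -/

/-- The preadditive category generated by `Cob(B)`: the same objects, with the free abelian groups
on the sets of morphisms. -/
abbrev AddCob (B : Finset Circle) : Type := Free ℤ (Cob B)

/-- Cochain complexes of finite length: only finitely many terms are not the zero object. -/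
def finiteLength (C : Type*) [Category C] [Preadditive C] : ObjectProperty (CochainComplex C ℤ) :=
  fun K => {i : ℤ | ¬ Limits.IsZero (K.X i)}.Finite

/-- The category `Kom(C)` of complexes of finite length in `C` and chain maps. -/
abbrev Kom (C : Type*) [Category C] [Preadditive C] : Type _ := (finiteLength C).FullSubcategory

namespace OrientedTangleDiagram

variable (T : OrientedTangleDiagram)

/-- The number of negative crossings. -/
def nNeg : ℕ := (Finset.univ.filter fun k => T.sign k = -1).card

/-- The states placed in homological degree `i`: those with exactly `i + n₋` letters `1`. -/
abbrev State (i : ℤ) : Type :=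
  {w : Fin T.n → Bool // ((Finset.univ.filter fun k => w k = true).card : ℤ) = i + T.nNeg}

/-- The term of the Khovanov bracket in degree `i`: the formal direct sum of the smoothings
associated to the states of this degree. -/
def bracketX (i : ℤ) : Mat_ (AddCob T.boundary) where
  ι := T.State i
  X w := Free.of ℤ (T.smoothing w.1)

open Classical in
/-- The differential of the Khovanov bracket: the entry from `w` to `w'` is the signed saddle
cobordism if there is an arrow from `w` to `w'` (which is then at exactly one letter `j`), and zero
otherwise. -/
def bracketD (i : ℤ) : T.bracketX i ⟶ T.bracketX (i + 1) := fun w w' =>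
  ∑ j : Fin T.n, if h : IsArrow j w.1 w'.1 then
    arrowSign j w.1 • (Free.embedding ℤ (Cob T.boundary)).map (Quotient.mk _ (T.saddle h))
  else 0

end OrientedTangleDiagram

end Khovanov

end

/-!
Two saddles at different crossings are supported over disjoint disks, so either of them can be
delayed, by reparametrizing the height over its own disk only, without moving the other one. Hence
both orders of performing them are isotopic to the cobordism in which the two saddles happen
simultaneously in the upper half of the cylinder, and the smoothings of a diagram form a commutative
cube. The signs `(-1) ^ ∑_{k < j} w_k` make its faces anticommute, because raising the letters `j`
and `k` in either order picks up signs that differ exactly by the contribution of the smaller letter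
to the sign of the larger one. In `∂ ∘ ∂` the two paths around each face therefore cancel.
-/

noncomputable section

namespace Khovanov

/-! ### Vertical isotopies -/

lemma strictMono_convexComb {α : Type*} [Preorder α] {a b : ℝ} {f g : α → Icc a b}
    (hf : StrictMono f) (hg : StrictMono g) (s : unitInterval) :
    StrictMono fun t => Icc.convexComb (f t) (g t) s := fun t t' h => by
  have hft : (f t : ℝ) < f t' := hf h
  have hgt : (g t : ℝ) < g t' := hg h
  simpa only [← Subtype.coe_lt_coe, Icc.coe_convexComb, AffineMap.lineMap_apply_module, smul_eq_mul]
    using lineMap_strict_mono_endpoints hft hgt s.2.1 s.2.2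

lemma surjective_of_continuous_of_apply_eq {X : Type*} [TopologicalSpace X] [PreconnectedSpace X]
    {f : X → unitInterval} (hf : Continuous f) {x y : X} (hx : f x = 0) (hy : f y = 1) :
    Function.Surjective f := fun _ =>
  intermediate_value_univ x y hf
    ⟨hx.trans_le unitInterval.nonneg', unitInterval.le_one'.trans_eq hy.symm⟩

lemma Isotopic.of_fibrewise_reparam {S S' : Set Cylinder} (f : Disk → unitInterval → unitInterval)
    (hf : Continuous fun p : Cylinder => f p.1 p.2) (hm : ∀ z, StrictMono (f z))
    (h0 : ∀ z, f z 0 = 0) (h1 : ∀ z, f z 1 = 1)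
    (h : ∀ z t, (z, f z t) ∈ S' ↔ (z, t) ∈ S) : Isotopic S S' := by
  let H (s : unitInterval) (p : Cylinder) : Cylinder := (p.1, Icc.convexComb p.2 (f p.1 p.2) s)
  have continuous_H : Continuous fun q : unitInterval × Cylinder => H q.1 q.2 := by
    have hfq : Continuous fun q : unitInterval × Cylinder => f q.2.1 q.2.2 := hf.comp continuous_snd
    exact (by fun_prop : Continuous fun q : unitInterval × Cylinder => q.2.1).prodMk
      (Icc.continuous_convexComb_prod.comp
        ((by fun_prop : Continuous fun q : unitInterval × Cylinder => q.2.2).prodMk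
          (hfq.prodMk continuous_fst)))
  have continuous_H_right (s : unitInterval) : Continuous (H s) :=
    continuous_H.comp (Continuous.prodMk_right s)
  have bijective_fibre (s : unitInterval) (z : Disk) :
      Function.Bijective fun t => Icc.convexComb t (f z t) s :=
    ⟨(strictMono_convexComb strictMono_id (hm z) s).injective,
      surjective_of_continuous_of_apply_eq
        (continuous_snd.comp ((continuous_H_right s).comp (Continuous.prodMk_right z)))
        (x := 0) (y := 1) (by rw [h0, Icc.convexComb_eq]) (by rw [h1, Icc.convexComb_eq])⟩
  have bijective_H (s : unitInterval) : Function.Bijective (H s) := by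
    refine ⟨?_, ?_⟩
    · rintro ⟨z, t⟩ ⟨z', t'⟩ e
      obtain ⟨rfl, e⟩ := Prod.mk.inj e
      exact congrArg (Prod.mk z) ((bijective_fibre s z).injective e)
    · rintro ⟨z, t⟩
      obtain ⟨t', rfl⟩ := (bijective_fibre s z).surjective t
      exact ⟨(z, t'), rfl⟩
  refine ⟨H, continuous_H, fun s => isHomeomorph_iff_continuous_bijective.2
    ⟨continuous_H_right s, bijective_H s⟩, ?_, ?_, ?_, ?_, fun _ _ _ => Iff.rfl⟩
  · exact funext fun p => congrArg (Prod.mk p.1) (Icc.convexComb_zero _ _)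
  · refine (image_eq_iff (bijective_H 1)).2 fun p => ?_
    simpa only [H, Icc.convexComb_one] using h p.1 p.2
  · intro s z; simp only [H, h0, Icc.convexComb_eq]
  · intro s z; simp only [H, h1, Icc.convexComb_eq]

lemma exists_continuous_cutoff {X : Type*} [TopologicalSpace X] [NormalSpace X] {K U : Set X}
    (hK : IsClosed K) (hU : IsOpen U) (hKU : K ⊆ U) :
    ∃ ρ : X → unitInterval, Continuous ρ ∧ (∀ p ∈ K, ρ p = 1) ∧ ∀ p ∉ U, ρ p = 0 := by
  obtain ⟨ρ, h0, h1, hI⟩ := exists_continuous_zero_one_of_isClosed hU.isClosed_compl hK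
    (disjoint_compl_left_iff_subset.2 hKU)
  exact ⟨fun p => ⟨ρ p, hI p⟩, ρ.continuous.subtype_mk hI, fun p hp => Subtype.ext (h1 hp),
    fun p hp => Subtype.ext (h0 hp)⟩

/-! ### Delaying a saddle -/

lemma upper_eq_zero_of_le {t : unitInterval} (h : (t : ℝ) ≤ 1 / 2) : upper t = 0 :=
  projIcc_eq_zero.2 (by linarith)

lemma lower_eq_one_of_ge {t : unitInterval} (h : 1 / 2 ≤ (t : ℝ)) : lower t = 1 :=
  projIcc_eq_one.2 (by linarith)

lemma saddleLevel_lower (t : unitInterval) : saddleLevel (lower t) = saddleLevel (2 * t) := by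
  rcases le_total (t : ℝ) (1 / 2) with h | h
  · rw [coe_lower h]
  · rw [lower_eq_one_of_ge h, saddleLevel_of_ge (by norm_num), saddleLevel_of_ge (by linarith)]

lemma saddleLevel_upper (t : unitInterval) : saddleLevel (upper t) = saddleLevel (2 * t - 1) := by
  rcases le_total (t : ℝ) (1 / 2) with h | h
  · rw [upper_eq_zero_of_le h, saddleLevel_of_le (by norm_num), saddleLevel_of_le (by linarith)]
  · rw [coe_upper h]

/-- The piecewise linear reparametrization of the height, with slopes `5`, `1` and `1 / 5`, which
moves a saddle from the lower to the upper half of a stack: it translates `[1/8, 3/8]`, where the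
saddle in the lower half takes place, to `[5/8, 7/8]`. -/
def delay (t : unitInterval) : unitInterval :=
  ⟨min (5 * t) (min (t + 1 / 2) ((t + 4) / 5)), by
    have h0 := t.2.1
    have h1 := t.2.2
    exact ⟨le_min (by linarith) (le_min (by linarith) (by linarith)),
      (min_le_right _ _).trans ((min_le_right _ _).trans (by linarith))⟩⟩

lemma coe_delay (t : unitInterval) :
    (delay t : ℝ) = min (5 * (t : ℝ)) (min (t + 1 / 2) ((t + 4) / 5)) := rfl

lemma continuous_delay : Continuous delay := by unfold delay; fun_prop

lemma strictMono_delay : StrictMono delay := fun a b h => by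
  have h : (a : ℝ) < b := h
  rw [← Subtype.coe_lt_coe, coe_delay, coe_delay]
  exact min_lt_min (by linarith) (min_lt_min (by linarith) (by linarith))

lemma delay_zero : delay 0 = 0 := by ext; norm_num [coe_delay]

lemma delay_one : delay 1 = 1 := by ext; norm_num [coe_delay]

lemma saddleLevel_upper_delay (t : unitInterval) :
    saddleLevel (upper (delay t)) = saddleLevel (lower t) := by
  rw [saddleLevel_upper, saddleLevel_lower, coe_delay]
  rcases le_total (t : ℝ) (1 / 8) with h | h
  · have hle := min_le_left (5 * (t : ℝ)) (min (t + 1 / 2) ((t + 4) / 5))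
    rw [saddleLevel_of_le (by linarith), saddleLevel_of_le (by linarith)]
  rcases le_total (t : ℝ) (3 / 8) with h' | h'
  · rw [min_eq_right (min_le_of_left_le (by linarith)), min_eq_left (by linarith)]
    congr 1
    ring
  · have hge : 7 / 8 ≤ min (5 * (t : ℝ)) (min (t + 1 / 2) ((t + 4) / 5)) :=
      le_min (by linarith) (le_min (by linarith) (by linarith))
    rw [saddleLevel_of_ge (by linarith), saddleLevel_of_ge (by linarith)]

/-! ### Arrows of the cube and their signs -/

lemma filter_update_true {n : ℕ} (w : Fin n → Bool) (j : Fin n) :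
    (Finset.univ.filter fun i => Function.update w j true i = true) =
      insert j (Finset.univ.filter fun i => w i = true) := by
  ext i
  by_cases hi : i = j
  · subst hi; simp
  · simp [hi]

namespace OrientedTangleDiagram

section Arrows

variable {n : ℕ} {w u x : Fin n → Bool} {j k : Fin n}

lemma IsArrow.ne (hj : IsArrow j w u) (hk : IsArrow k u x) : j ≠ k := by
  rintro rfl
  simpa [hj.2] using hk.1

lemma IsArrow.apply_source_eq_false (hj : IsArrow j w u) (hk : IsArrow k u x) : w k = false := by
  simpa [hj.2, (hj.ne hk).symm] using hk.1

lemma IsArrow.flip (hj : IsArrow j w u) (hk : IsArrow k u x) :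
    IsArrow k w (Function.update w k true) ∧ IsArrow j (Function.update w k true) x := by
  refine ⟨⟨hj.apply_source_eq_false hk, rfl⟩, ?_, ?_⟩
  · rw [Function.update_of_ne (hj.ne hk), hj.1]
  · rw [hk.2, hj.2, Function.update_comm (hj.ne hk)]

lemma IsArrow.card_eq (h : IsArrow j w u) :
    (Finset.univ.filter fun i => u i = true).card =
      (Finset.univ.filter fun i => w i = true).card + 1 := by
  rw [h.2, filter_update_true, Finset.card_insert_of_notMem (by simp [h.1])]

lemma IsArrow.arrowSign_target (h : IsArrow j w u) (k : Fin n) :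
    arrowSign k u = if j < k then -arrowSign k w else arrowSign k w := by
  have arrowSign_eq (v : Fin n → Bool) : arrowSign k v =
      (-1) ^ ((Finset.univ.filter fun i => v i = true).filter (· < k)).card := by
    simp only [arrowSign, Finset.filter_filter, and_comm]
  rw [arrowSign_eq, arrowSign_eq, h.2, filter_update_true, Finset.filter_insert]
  split_ifs
  · rw [Finset.card_insert_of_notMem (by simp [h.1]), pow_succ, mul_neg_one]
  · rfl

lemma IsArrow.arrowSign_mul_anticomm {v : Fin n → Bool} (hj : IsArrow j w u) (hk : IsArrow k u x)
    (hk' : IsArrow k w v) :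
    arrowSign j w * arrowSign k u = -(arrowSign k w * arrowSign j v) := by
  rw [hj.arrowSign_target, hk'.arrowSign_target]
  rcases (hj.ne hk).lt_or_gt with h | h
  · rw [if_pos h, if_neg h.le.not_gt]; ring
  · rw [if_neg h.le.not_gt, if_pos h]; ring

end Arrows

/-! ### Saddles at different crossings commute -/

variable (T : OrientedTangleDiagram)

/-- The subset of the cylinder whose slice at height `t` is the resolution of the diagram with
parameters `F t`. -/
def movie (F : unitInterval → Fin T.n → ℝ) : Set Cylinder := {p | p.1 ∈ T.resolve (F p.2)}

lemma mem_resolve_congr {f g : Fin T.n → ℝ} {p : Disk}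
    (h : ∀ k z, ‖z‖ < 1 → p = T.chart k z → f k = g k) : p ∈ T.resolve f ↔ p ∈ T.resolve g := by
  rcases T.mem_outside_or p with hp | ⟨k, z, rfl⟩
  · rw [T.mem_resolve_of_notMem _ hp, T.mem_resolve_of_notMem _ hp]
  · rw [chart_mem_resolve, chart_mem_resolve]
    rcases lt_or_ge ‖z‖ 1 with hz | hz
    · rw [h k z hz rfl]
    · rw [bump_of_one_le hz, mul_zero, mul_zero]

lemma isotopic_movie_of_reparam {F F' : unitInterval → Fin T.n → ℝ} (j : Fin T.n)
    {φ : unitInterval → unitInterval} (hφ : Continuous φ) (hm : StrictMono φ)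
    (h0 : φ 0 = 0) (h1 : φ 1 = 1) (hj : ∀ t, F' (φ t) j = F t j)
    (hne : ∀ t, ∀ k ≠ j, F' t k = F t k) : Isotopic (T.movie F) (T.movie F') := by
  have isOpenEmbedding := T.isOpenEmbedding_chart j
  obtain ⟨ρ, hρ, ρ_eq_one, ρ_eq_zero⟩ := exists_continuous_cutoff
    ((isCompact_closedBall 0 1).image isOpenEmbedding.continuous).isClosed
    isOpenEmbedding.isOpen_range (image_subset_range _ _)
  refine Isotopic.of_fibrewise_reparam (fun p t => Icc.convexComb t (φ t) (ρ p))
    (Icc.continuous_convexComb_prod.comp (continuous_snd.prodMk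
      ((hφ.comp continuous_snd).prodMk (hρ.comp continuous_fst))))
    (fun p => strictMono_convexComb strictMono_id hm _)
    (fun p => by rw [h0, Icc.convexComb_eq]) (fun p => by rw [h1, Icc.convexComb_eq])
    fun p t => T.mem_resolve_congr ?_
  rintro k z hz rfl
  obtain rfl | hk := eq_or_ne k j
  · have hρz : ρ (T.chart k z) = 1 := ρ_eq_one _ ⟨z, mem_closedBall_zero_iff.2 hz.le, rfl⟩
    simp only [hρz, Icc.convexComb_one, hj]
  · have hρz : ρ (T.chart k z) = 0 :=
      ρ_eq_zero _ (Set.disjoint_left.1 (T.disjoint_chart hk) ⟨z, rfl⟩)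
    simp only [hρz, Icc.convexComb_zero, hne _ k hk]

/-- The parameters of a stack of two saddles, the first at the `j`-th and the second at the `k`-th
crossing. -/
def consecutiveSaddles (w : Fin T.n → Bool) (j k : Fin T.n) (t : unitInterval) (l : Fin T.n) : ℝ :=
  if l = j then saddleLevel (lower t) else if l = k then saddleLevel (upper t) else level (w l)

/-- The parameters of a movie with saddles at the `j`-th and the `k`-th crossing that take place
simultaneously, in the upper half of the cylinder. -/
def simultaneousSaddles (w : Fin T.n → Bool) (j k : Fin T.n) (t : unitInterval) (l : Fin T.n) : ℝ :=
  if l = j ∨ l = k then saddleLevel (upper t) else level (w l)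

lemma isotopic_consecutiveSaddles_simultaneousSaddles (w : Fin T.n → Bool) (j k : Fin T.n) :
    Isotopic (T.movie (T.consecutiveSaddles w j k)) (T.movie (T.simultaneousSaddles w j k)) := by
  refine T.isotopic_movie_of_reparam j continuous_delay strictMono_delay delay_zero delay_one
    (fun t => ?_) fun t l hl => ?_
  · simp only [consecutiveSaddles, simultaneousSaddles, true_or, if_true, saddleLevel_upper_delay]
  · simp only [consecutiveSaddles, simultaneousSaddles, hl, false_or, if_false]

section Saddles

variable {T} {w u v x : Fin T.n → Bool} {j k : Fin T.n}

lemma saddleFamily_lower (hj : IsArrow j w u) (hk : IsArrow k u x) {t : unitInterval}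
    (ht : (t : ℝ) ≤ 1 / 2) : T.saddleFamily w j (lower t) = T.consecutiveSaddles w j k t := by
  funext l
  have upper_level : saddleLevel (upper t) = level (w k) := by
    rw [upper_eq_zero_of_le ht, saddleLevel_of_le (by norm_num), hj.apply_source_eq_false hk]
  by_cases hlk : l = k
  · simp only [saddleFamily, consecutiveSaddles, hlk, if_true, upper_level]
  · simp only [saddleFamily, consecutiveSaddles, hlk, if_false]

lemma saddleFamily_upper (hj : IsArrow j w u) (hk : IsArrow k u x) {t : unitInterval}
    (ht : 1 / 2 ≤ (t : ℝ)) : T.saddleFamily u k (upper t) = T.consecutiveSaddles w j k t := by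
  funext l
  obtain rfl | hlj := eq_or_ne l j
  · simp only [saddleFamily, consecutiveSaddles, hj.ne hk, if_true, if_false, hj.2,
      Function.update_self, lower_eq_one_of_ge ht]
    exact (saddleLevel_of_ge (by norm_num)).symm
  · simp only [saddleFamily, consecutiveSaddles, hj.2, Function.update_of_ne hlj, hlj, if_false]

lemma carrier_saddle_comp_saddle (hj : IsArrow j w u) (hk : IsArrow k u x) :
    ((T.saddle hj).comp (T.saddle hk)).carrier = T.movie (T.consecutiveSaddles w j k) := by
  have fits := (T.saddle hj).fits (T.saddle hk)
  ext ⟨p, t⟩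
  rcases le_total (t : ℝ) (1 / 2) with ht | ht
  · refine (mem_stack_lower fits ht).trans ?_
    change p ∈ T.resolve (T.saddleFamily w j (lower t)) ↔ p ∈ T.resolve _
    rw [saddleFamily_lower hj hk ht]
  · refine (mem_stack_upper fits ht).trans ?_
    change p ∈ T.resolve (T.saddleFamily u k (upper t)) ↔ p ∈ T.resolve _
    rw [saddleFamily_upper hj hk ht]

lemma isotopic_saddle_comp_saddle (hj : IsArrow j w u) (hk : IsArrow k u x) :
    Isotopic ((T.saddle hj).comp (T.saddle hk)).carrier
      (T.movie (T.simultaneousSaddles w j k)) := by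
  rw [carrier_saddle_comp_saddle]
  exact T.isotopic_consecutiveSaddles_simultaneousSaddles w j k

lemma saddle_comp_saddle_comm (hj : IsArrow j w u) (hk : IsArrow k u x) (hk' : IsArrow k w v)
    (hj' : IsArrow j v x) :
    (T.saddle hj).comp (T.saddle hk) ≈ (T.saddle hk').comp (T.saddle hj') := by
  have symm : T.simultaneousSaddles w j k = T.simultaneousSaddles w k j := by
    funext t l
    simp only [simultaneousSaddles, or_comm]
  have h := isotopic_saddle_comp_saddle hj hk
  rw [symm] at h
  exact h.trans (isotopic_saddle_comp_saddle hk' hj').symm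

end Saddles

end OrientedTangleDiagram

/-! ### The total complex of a commutative cube -/

open OrientedTangleDiagram (IsArrow arrowSign)

lemma sum_sum_eq_zero_of_add_swap {ι M : Type*} [Fintype ι] [AddCommMonoid M] (a : ι → ι → M)
    (add_swap : ∀ i j, a i j + a j i = 0) (diag : ∀ i, a i i = 0) : ∑ i, ∑ j, a i j = 0 := by
  rw [← Fintype.sum_prod_type']
  refine Finset.sum_involution (fun p _ => p.swap) (fun p _ => add_swap p.1 p.2) ?_
    (fun _ _ => Finset.mem_univ _) fun p _ => p.swap_swap
  rintro ⟨i, j⟩ - hne heq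
  obtain rfl : j = i := congrArg Prod.fst heq
  exact hne (diag j)

/-- A commutative `n`-dimensional cube in a category: objects at the vertices, morphisms along the
arrows that raise one letter from `0` (`false`) to `1` (`true`), and commuting square faces. -/
structure CommutativeCube (n : ℕ) (C : Type*) [Category* C] where
  obj : (Fin n → Bool) → C
  map {w w' : Fin n → Bool} {j : Fin n} : IsArrow j w w' → (obj w ⟶ obj w')
  comm {w u v x : Fin n → Bool} {j k : Fin n} (hj : IsArrow j w u) (hk : IsArrow k u x)
    (hk' : IsArrow k w v) (hj' : IsArrow j v x) : map hj ≫ map hk = map hk' ≫ map hj'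

namespace CommutativeCube

variable {n : ℕ} {C : Type*} [Category* C]

/-- The image of a commutative cube under a functor. -/
def mapFunctor (X : CommutativeCube n C) {D : Type*} [Category* D] (F : C ⥤ D) :
    CommutativeCube n D where
  obj w := F.obj (X.obj w)
  map h := F.map (X.map h)
  comm hj hk hk' hj' := by simp only [← F.map_comp, X.comm hj hk hk' hj']

/-- The vertices in degree `i` of the `n`-dimensional cube, where the vertex all of whose letters
are `0` is placed in degree `-m`. -/
abbrev Vertex (n : ℕ) (m i : ℤ) : Type :=
  {w : Fin n → Bool // ((Finset.univ.filter fun k => w k = true).card : ℤ) = i + m}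

lemma card_eq_of_isArrow {m i : ℤ} (w : Vertex n m i) {w' : Fin n → Bool} {j : Fin n}
    (h : IsArrow j w.1 w') :
    ((Finset.univ.filter fun k => w' k = true).card : ℤ) = i + 1 + m := by
  rw [h.card_eq, Nat.cast_succ, w.2, add_right_comm]

lemma isEmpty_vertex {m i : ℤ} (h : i ∉ Icc (-m) (n - m)) : IsEmpty (Vertex n m i) := by
  refine ⟨fun w => h ⟨neg_le_iff_add_nonneg.2 ?_, le_sub_iff_add_le.2 ?_⟩⟩
  · rw [← w.2]
    exact Int.natCast_nonneg _
  · rw [← w.2]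
    exact_mod_cast card_finset_fin_le _

variable [Preadditive C] (X : CommutativeCube n C)

open Classical in
/-- The signed morphism along the arrow from `w` to `w'` at the `j`-th letter, extended by zero to
all pairs of vertices. -/
def signedMap (j : Fin n) (w w' : Fin n → Bool) : X.obj w ⟶ X.obj w' :=
  if h : IsArrow j w w' then arrowSign j w • X.map h else 0

lemma signedMap_of_isArrow {j : Fin n} {w w' : Fin n → Bool} (h : IsArrow j w w') :
    X.signedMap j w w' = arrowSign j w • X.map h := dif_pos h

lemma signedMap_of_not_isArrow {j : Fin n} {w w' : Fin n → Bool} (h : ¬IsArrow j w w') :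
    X.signedMap j w w' = 0 := dif_neg h

/-- The composite of the signed morphisms from `w` to `x` that change the `j`-th and then the `k`-th
letter. -/
def signedPath (w x : Fin n → Bool) (j k : Fin n) : X.obj w ⟶ X.obj x :=
  X.signedMap j w (Function.update w j true) ≫ X.signedMap k (Function.update w j true) x

lemma signedPath_eq_zero {w x : Fin n → Bool} {j k : Fin n}
    (h : ¬(IsArrow j w (Function.update w j true) ∧ IsArrow k (Function.update w j true) x)) :
    X.signedPath w x j k = 0 := by
  rw [signedPath]
  rcases not_and_or.1 h with h | h
  · rw [X.signedMap_of_not_isArrow h, Limits.zero_comp]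
  · rw [X.signedMap_of_not_isArrow h, Limits.comp_zero]

lemma signedPath_self (w x : Fin n → Bool) (j : Fin n) : X.signedPath w x j j = 0 :=
  X.signedPath_eq_zero fun h => h.1.ne h.2 rfl

lemma signedMap_comp_signedMap {w u x : Fin n → Bool} {j k : Fin n} (hj : IsArrow j w u)
    (hk : IsArrow k u x) : X.signedMap j w u ≫ X.signedMap k u x =
      (arrowSign j w * arrowSign k u) • (X.map hj ≫ X.map hk) := by
  rw [X.signedMap_of_isArrow hj, X.signedMap_of_isArrow hk, Preadditive.zsmul_comp,
    Preadditive.comp_zsmul, smul_smul]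

lemma signedPath_anticomm (w x : Fin n → Bool) (j k : Fin n) :
    X.signedPath w x j k = -X.signedPath w x k j := by
  by_cases h : IsArrow j w (Function.update w j true) ∧ IsArrow k (Function.update w j true) x
  · obtain ⟨hj, hk⟩ := h
    obtain ⟨hk', hj'⟩ := hj.flip hk
    rw [signedPath, signedPath, X.signedMap_comp_signedMap hj hk,
      X.signedMap_comp_signedMap hk' hj', X.comm hj hk hk' hj',
      hj.arrowSign_mul_anticomm hk hk', neg_smul]
  · rw [X.signedPath_eq_zero h, X.signedPath_eq_zero fun h' => h (h'.1.flip h'.2), neg_zero]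

lemma sum_signedMap_comp_signedMap {m i : ℤ} (w : Vertex n m i) (x : Fin n → Bool) (j k : Fin n) :
    ∑ u : Vertex n m (i + 1), X.signedMap j w.1 u.1 ≫ X.signedMap k u.1 x =
      X.signedPath w.1 x j k := by
  have zero_of_ne (u : Vertex n m (i + 1)) (hu : u.1 ≠ Function.update w.1 j true) :
      X.signedMap j w.1 u.1 ≫ X.signedMap k u.1 x = 0 := by
    rw [X.signedMap_of_not_isArrow fun h => hu h.2, Limits.zero_comp]
  by_cases h : IsArrow j w.1 (Function.update w.1 j true)
  · exact Fintype.sum_eq_single ⟨_, card_eq_of_isArrow w h⟩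
      fun u hu => zero_of_ne u fun e => hu (Subtype.ext e)
  · rw [X.signedPath_eq_zero fun h' => h h'.1]
    exact Finset.sum_eq_zero fun u _ => by
      rw [X.signedMap_of_not_isArrow fun hu => h (hu.2 ▸ hu), Limits.zero_comp]

/-- The term in degree `i` of the total complex of a commutative cube: the formal direct sum of the
objects at the vertices in degree `i`. -/
def totalX (m i : ℤ) : Mat_ C where
  ι := Vertex n m i
  X w := X.obj w.1

/-- The differential of the total complex of a commutative cube. -/
def totalD (m i : ℤ) : X.totalX m i ⟶ X.totalX m (i + 1) := fun w w' =>
  ∑ j : Fin n, X.signedMap j w.1 w'.1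

lemma totalD_comp_totalD (m i : ℤ) : X.totalD m i ≫ X.totalD m (i + 1) = 0 := by
  refine Mat_.hom_ext _ _ fun (w : Vertex n m i) (x : Vertex n m (i + 1 + 1)) => ?_
  change ∑ u : Vertex n m (i + 1),
    (∑ j, X.signedMap j w.1 u.1) ≫ ∑ k, X.signedMap k u.1 x.1 = 0
  calc ∑ u : Vertex n m (i + 1), (∑ j, X.signedMap j w.1 u.1) ≫ ∑ k, X.signedMap k u.1 x.1
    _ = ∑ u : Vertex n m (i + 1), ∑ j, ∑ k, X.signedMap j w.1 u.1 ≫ X.signedMap k u.1 x.1 := by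
      simp_rw [Preadditive.sum_comp, Preadditive.comp_sum]
    _ = ∑ j, ∑ k, ∑ u : Vertex n m (i + 1), X.signedMap j w.1 u.1 ≫ X.signedMap k u.1 x.1 := by
      rw [Finset.sum_comm]
      exact Finset.sum_congr rfl fun j _ => Finset.sum_comm
    _ = ∑ j, ∑ k, X.signedPath w.1 x.1 j k := by simp only [sum_signedMap_comp_signedMap]
    _ = 0 := sum_sum_eq_zero_of_add_swap _
      (fun j k => by rw [X.signedPath_anticomm, neg_add_cancel]) (X.signedPath_self w.1 x.1)

lemma isZero_totalX {m i : ℤ} (h : i ∉ Icc (-m) (n - m)) : Limits.IsZero (X.totalX m i) := by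
  rw [Limits.IsZero.iff_id_eq_zero]
  exact Mat_.hom_ext _ _ fun w => (isEmpty_vertex h).elim w

/-- The total complex of a commutative cube, as a complex of finite length. -/
def total (m : ℤ) : Kom (Mat_ C) where
  obj := CochainComplex.of (X.totalX m) (X.totalD m) (X.totalD_comp_totalD m)
  property := (finite_Icc (-m) (n - m)).subset fun _ hi => by_contra fun h => hi (X.isZero_totalX h)

end CommutativeCube

/-! ### The Khovanov bracket as a total complex -/

namespace OrientedTangleDiagram

variable (T : OrientedTangleDiagram)

/-- The cube of smoothings of a diagram, whose arrows are the saddle cobordisms up to isotopy. -/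
def smoothingCube : CommutativeCube T.n (Cob T.boundary) where
  obj := T.smoothing
  map h := Quotient.mk _ (T.saddle h)
  comm hj hk hk' hj' := Quotient.sound (saddle_comp_saddle_comm hj hk hk' hj')

/-- The cube of smoothings of a diagram in the preadditive category generated by `Cob(∂T)`; its
total complex is the Khovanov bracket. -/
def additiveCube : CommutativeCube T.n (AddCob T.boundary) :=
  T.smoothingCube.mapFunctor (Free.embedding ℤ (Cob T.boundary))

lemma bracketD_comp_bracketD (i : ℤ) : T.bracketD i ≫ T.bracketD (i + 1) = 0 :=
  T.additiveCube.totalD_comp_totalD T.nNeg i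

/-- The Khovanov bracket as a complex of finite length; its objects and differentials unfold to
`bracketX` and `bracketD`. -/
def bracket : Kom (Mat_ (AddCob T.boundary)) := T.additiveCube.total T.nNeg

lemma bracket_obj :
    T.bracket.obj = CochainComplex.of T.bracketX T.bracketD T.bracketD_comp_bracketD := rfl

end OrientedTangleDiagram

end Khovanov

end

theorem mainTheorem1 (T : Khovanov.OrientedTangleDiagram) :
    ∃ (hd : ∀ i : ℤ, T.bracketD i ≫ T.bracketD (i + 1) = 0)
      (K : Khovanov.Kom (CategoryTheory.Mat_ (Khovanov.AddCob T.boundary))),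
      K.obj = CochainComplex.of T.bracketX T.bracketD hd :=
  ⟨T.bracketD_comp_bracketD, T.bracket, T.bracket_obj⟩
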